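/- Throughout, $G$ is a totally disconnected locally compact (Hausdorff) group. **Definitions.** Subgroups $H,K\le G$ are *locally equivalent* if $H\cap U=K\cap U$ for some open subgroup $U$; $[H]$ is the class of $H$, and $[K]\le[H]$ means $K\cap U\le H$ for some open subgroup $U$. A subgroup is *locally normal* if it is compact with open normaliser; $\mathcal{LN}(G)$ is the set of classes of locally normal subgroups. For subgroups $H,K$, $\mathrm{QC}_H(K)$ is the set of $h\in H$ that centralise $K\cap U$ for some open subgroup $U$; $\mathrm{QC}_G(K)$ depends only on $[K]$, and $[K]^\bot:=[\mathrm{QC}_G(K)]$. $G$ is *locally C-stable* if the only element of $G$ with open centraliser is $1$ and, for every locally normal $H$, the group $\mathrm{QC}_G(H)\cap\mathrm{QC}_G(\mathrm C_G(H))$ is discrete and torsion-free. Put $\mathcal{LC}(G)=\{\alpha^\bot:\alpha\in\mathcal{LN}(G)\}$, and let $\mathcal{LD}(G)$ be the set of classes $[K]$ where $K$ is locally normal and is a direct factor of a closed subgroup of finite index of some compact open subgroup of $G$. Both are partially ordered by the order on local classes, and $G$ acts on both by conjugation. Let $G$ act by automorphisms on a Boolean algebra $\mathcal A$ with kernel $N$,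 and let $\mathrm{rist}_G(a)=\{g: gb=b \text{ for all } b\le a^\bot\}$, where $a^\bot$ is the complement of $a$. The action is *smooth* if all point stabilisers $G_a$ are open; *weakly branch* if it is smooth and $\mathrm{rist}_G(a)\ne N$ for all $a\ne 0$; *locally branch* if it is weakly branch and $\mathrm{rist}_G(a)\,\mathrm{rist}_G(a^\bot)$ is open for all $a\in\mathcal A$. An action by homeomorphisms on a profinite space $X$ is weakly (locally) branch if the action on the Boolean algebra $\mathrm{Clop}(X)$ of clopen sets is so. $\mathfrak S(\mathcal A)$ is the Stone space (space of ultrafilters) of $\mathcal A$, with the induced action. **Theorem.** Let $G$ be locally C-stable. Then $\mathcal{LC}(G)$ and $\mathcal{LD}(G)$, with the orders above, are Boolean algebras, with complementation $\bot$, on which $G$ acts by automorphisms, and: 1. If $G$ acts faithfully on $\mathcal{LC}(G)$, then the induced action of $G$ on $\mathfrak S(\mathcal{LC}(G))$ is a faithful weakly branch action. 2. Every faithful weakly branch action of $G$ on a Boolean algebra $\mathcal A$ is $G$-equivariantly isomorphic to the action of $G$ on some $G$-invariant subalgebra of $\mathcal{LC}(G)$, and $\mathfrak S(\mathcal A)$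 is the image of $\mathfrak S(\mathcal{LC}(G))$ under a continuous $G$-equivariant surjection. If $X$ is a profinite space with a faithful weakly branch action of $G$, then $\mathrm{Clop}(X)$ is $G$-equivariantly isomorphic to a $G$-invariant subalgebra of $\mathcal{LC}(G)$, and there is a continuous $G$-equivariant surjection $\mathfrak S(\mathcal{LC}(G))\to X$. 3. Let $G$ have a faithful locally branch action on a Boolean algebra $\mathcal A$ (respectively, on a profinite space $X$, and put $\mathcal A=\mathrm{Clop}(X)$). Suppose that $G$ is $\sigma$-compact or, more generally, that for every $a\in\mathcal A$ there is a compact open subgroup $U\le G$ such that $(\mathrm{rist}_G(a)\cap U)\,(\mathrm{rist}_G(a^\bot)\cap U)$ is open in $G$. Then $\mathcal A$ is $G$-equivariantly isomorphic to a $G$-invariant subalgebra of $\mathcal{LD}(G)$. -/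

import Mathlib

open scoped Pointwise

namespace TDLC

universe u v

section Subgroups

variable {G : Type u} [Group G] [TopologicalSpace G]

/-- A locally normal subgroup: a compact subgroup whose normaliser is open. -/
def IsLocallyNormal (H : Subgroup G) : Prop :=
  IsCompact (H : Set G) ∧ IsOpen (Subgroup.normalizer (H : Set G) : Set G)

/-- Two subgroups are locally equivalent if they have the same intersection with some open subgroup.
(In a totally disconnected locally compact group every open subgroup contains a compact open one,
so compact open subgroups give the same relation.) -/
def LocallyEquivalent (H K : Subgroup G) : Prop :=
  ∃ U : OpenSubgroup G, H ⊓ (U : Subgroup G) = K ⊓ (U : Subgroup G)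

theorem locallyEquivalent_equivalence : Equivalence (LocallyEquivalent (G := G)) where
  refl _ := ⟨⊤, rfl⟩
  symm := fun ⟨U, h⟩ => ⟨U, h.symm⟩
  trans := by
    rintro H K L ⟨U, hU⟩ ⟨V, hV⟩
    refine ⟨U ⊓ V, ?_⟩
    rw [OpenSubgroup.toSubgroup_inf, ← inf_assoc, hU, inf_right_comm, hV, inf_right_comm, inf_assoc]

instance localSetoid (G : Type u) [Group G] [TopologicalSpace G] : Setoid (Subgroup G) :=
  ⟨LocallyEquivalent, locallyEquivalent_equivalence⟩

/-- Local equivalence classes `[H]` of subgroups of `G`. -/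
def LocalClass (G : Type u) [Group G] [TopologicalSpace G] : Type u :=
  Quotient (localSetoid G)

/-- The local equivalence class `[H]`. -/
def LocalClass.mk (H : Subgroup G) : LocalClass G := Quotient.mk (localSetoid G) H

/-- `[K] ≤ [H]` iff `K ∩ U ≤ H` for some open subgroup `U`. -/
instance : PartialOrder (LocalClass G) where
  le := Quotient.lift₂
    (fun K H => ∃ U : OpenSubgroup G, K ⊓ (U : Subgroup G) ≤ H) (by
      have key : ∀ K H K' H' : Subgroup G, LocallyEquivalent K K' → LocallyEquivalent H H' →
          (∃ U : OpenSubgroup G, K ⊓ (U : Subgroup G) ≤ H) →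
          ∃ U : OpenSubgroup G, K' ⊓ (U : Subgroup G) ≤ H' := by
        rintro K H K' H' ⟨V, hV⟩ ⟨W, hW⟩ ⟨U, hU⟩
        refine ⟨U ⊓ V ⊓ W, fun x hx => ?_⟩
        simp only [OpenSubgroup.toSubgroup_inf, Subgroup.mem_inf] at hx
        obtain ⟨h1, ⟨h2, h3⟩, h4⟩ := hx
        have h5 : x ∈ K ⊓ (V : Subgroup G) := hV ▸ ⟨h1, h3⟩
        have h6 : x ∈ H' ⊓ (W : Subgroup G) := hW ▸ ⟨hU ⟨h5.1, h2⟩, h4⟩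
        exact h6.1
      intro K H K' H' hK hH
      exact propext ⟨key K H K' H' hK hH,
        key K' H' K H (locallyEquivalent_equivalence.symm hK)
          (locallyEquivalent_equivalence.symm hH)⟩)
  le_refl := by
    rintro ⟨H⟩
    exact ⟨⊤, inf_le_left⟩
  le_trans := by
    rintro ⟨H⟩ ⟨K⟩ ⟨L⟩ ⟨U, hU⟩ ⟨V, hV⟩
    refine ⟨U ⊓ V, fun x hx => ?_⟩
    simp only [OpenSubgroup.toSubgroup_inf, Subgroup.mem_inf] at hx
    exact hV ⟨hU ⟨hx.1, hx.2.1⟩, hx.2.2⟩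
  le_antisymm := by
    rintro ⟨H⟩ ⟨K⟩ ⟨U, hU⟩ ⟨V, hV⟩
    refine Quotient.sound ⟨U ⊓ V, ?_⟩
    ext x
    simp only [OpenSubgroup.toSubgroup_inf, Subgroup.mem_inf]
    exact ⟨fun h => ⟨hU ⟨h.1, h.2.1⟩, h.2⟩, fun h => ⟨hV ⟨h.1, h.2.2⟩, h.2⟩⟩

/-- The structure lattice `LN(G)`: the local classes of locally normal subgroups. -/
def structureLattice (G : Type u) [Group G] [TopologicalSpace G] : Set (LocalClass G) :=
  {α | ∃ H : Subgroup G, IsLocallyNormal H ∧ LocalClass.mk H = α}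

/-- The quasi-centraliser `QC_H(K)`: the elements of `H` that centralise `K ∩ U` for some open
subgroup `U`. -/
def quasiCentraliser (H K : Subgroup G) : Subgroup G where
  carrier := {g | g ∈ H ∧ ∃ U : OpenSubgroup G,
    g ∈ Subgroup.centralizer ((K ⊓ (U : Subgroup G) : Subgroup G) : Set G)}
  one_mem' := ⟨H.one_mem, ⊤, Subgroup.one_mem _⟩
  mul_mem' := by
    rintro a b ⟨ha, U, hU⟩ ⟨hb, V, hV⟩
    refine ⟨H.mul_mem ha hb, U ⊓ V, Subgroup.mul_mem _ ?_ ?_⟩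
    · exact Subgroup.centralizer_le (SetLike.coe_subset_coe.2
        (inf_le_inf_left K (inf_le_left : (U : Subgroup G) ⊓ V ≤ U))) hU
    · exact Subgroup.centralizer_le (SetLike.coe_subset_coe.2
        (inf_le_inf_left K (inf_le_right : (U : Subgroup G) ⊓ V ≤ V))) hV
  inv_mem' := by
    rintro a ⟨ha, U, hU⟩
    exact ⟨H.inv_mem ha, U, Subgroup.inv_mem _ hU⟩

/-- `QC_G(K)` depends only on the local class of `K`. -/
theorem quasiCentraliser_congr {H K K' : Subgroup G} (h : LocallyEquivalent K K') :
    quasiCentraliser H K = quasiCentraliser H K' := by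
  have key : ∀ K K' : Subgroup G, LocallyEquivalent K K' →
      quasiCentraliser H K ≤ quasiCentraliser H K' := by
    rintro K K' ⟨V, hV⟩ g ⟨hg, U, hU⟩
    refine ⟨hg, U ⊓ V, Subgroup.centralizer_le (fun x hx => ?_) hU⟩
    have h5 : x ∈ K ⊓ (V : Subgroup G) := hV ▸ ⟨hx.1, hx.2.2⟩
    exact ⟨h5.1, hx.2.1⟩
  exact le_antisymm (key _ _ h) (key _ _ (locallyEquivalent_equivalence.symm h))

/-- The map `α ↦ α^⊥ = [QC_G(α)]`. -/
def LocalClass.perp : LocalClass G → LocalClass G :=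
  Quotient.lift (fun H => LocalClass.mk (quasiCentraliser ⊤ H))
    fun _ _ h => congrArg LocalClass.mk (quasiCentraliser_congr h)

/-- `G` has trivial quasi-centre: the only element with open centraliser is the identity. -/
def TrivialQuasiCentre (G : Type u) [Group G] [TopologicalSpace G] : Prop :=
  ∀ g : G, IsOpen (Subgroup.centralizer {g} : Set G) → g = 1

/-- A (closed) subgroup `H` is C-stable if `QC_G(H) ∩ QC_G(C_G(H))` is discrete and torsion-free. -/
def IsCStable (H : Subgroup G) : Prop :=
  DiscreteTopology
      ↥(quasiCentraliser ⊤ H ⊓ quasiCentraliser ⊤ (Subgroup.centralizer (H : Set G))) ∧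
    ∀ x ∈ quasiCentraliser ⊤ H ⊓ quasiCentraliser ⊤ (Subgroup.centralizer (H : Set G)),
      IsOfFinOrder x → x = 1

/-- `G` is locally C-stable: it has trivial quasi-centre and all its locally normal subgroups are
C-stable. -/
def IsLocallyCStable (G : Type u) [Group G] [TopologicalSpace G] : Prop :=
  TrivialQuasiCentre G ∧ ∀ H : Subgroup G, IsLocallyNormal H → IsCStable H

/-- `K` is a direct factor of `L`: `L` is the internal direct product of `K` and a subgroup `M`. -/
def IsDirectFactor (K L : Subgroup G) : Prop :=
  ∃ M : Subgroup G, (∀ k ∈ K, ∀ m ∈ M, k * m = m * k) ∧ K ⊓ M = ⊥ ∧ K ⊔ M = L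

/-- `K` is an almost direct factor of the closed subgroup `H`: it is a direct factor of a closed
subgroup `L` of finite index in `H`. -/
def IsAlmostDirectFactor (K H : Subgroup G) : Prop :=
  ∃ L : Subgroup G, L ≤ H ∧ IsClosed (L : Set G) ∧ L.relIndex H ≠ 0 ∧ IsDirectFactor K L

/-- The centraliser lattice `LC(G) = {α^⊥ | α ∈ LN(G)}`. -/
def CentraliserLattice (G : Type u) [Group G] [TopologicalSpace G] : Type u :=
  {γ : LocalClass G // ∃ α ∈ structureLattice G, γ = α.perp}

/-- The local class underlying an element of `LC(G)`. -/
def CentraliserLattice.cls (γ : CentraliserLattice G) : LocalClass G := γ.1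

/-- The local decomposition lattice `LD(G)`: the classes of the locally normal subgroups that are
almost direct factors of a compact open subgroup of `G`. -/
def DecompositionLattice (G : Type u) [Group G] [TopologicalSpace G] : Type u :=
  {γ : LocalClass G // ∃ K U : Subgroup G, IsLocallyNormal K ∧ IsOpen (U : Set G) ∧
    IsCompact (U : Set G) ∧ IsAlmostDirectFactor K U ∧ γ = LocalClass.mk K}

/-- The local class underlying an element of `LD(G)`. -/
def DecompositionLattice.cls (γ : DecompositionLattice G) : LocalClass G := γ.1

/-- Conjugation on local classes: `g [H] = [g H g⁻¹]`. -/
def LocalClass.conj [ContinuousMul G] (g : G) : LocalClass G → LocalClass G :=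
  Quotient.map' (Subgroup.map (MulAut.conj g).toMonoidHom) (by
    rintro H K ⟨U, hU⟩
    have hc : Continuous (MulAut.conj g⁻¹).toMonoidHom := by
      change Continuous fun x => g⁻¹ * x * g⁻¹⁻¹
      fun_prop
    refine ⟨U.comap (MulAut.conj g⁻¹).toMonoidHom hc, ?_⟩
    have key : ∀ L : Subgroup G, L.map (MulAut.conj g).toMonoidHom ⊓
        (U.comap (MulAut.conj g⁻¹).toMonoidHom hc : Subgroup G) =
        (L ⊓ (U : Subgroup G)).map (MulAut.conj g).toMonoidHom := by
      intro L
      ext x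
      constructor
      · rintro ⟨⟨y, hy, rfl⟩, hx⟩
        refine ⟨y, ⟨hy, ?_⟩, rfl⟩
        have hx' : g⁻¹ * (g * y * g⁻¹) * g⁻¹⁻¹ ∈ U := hx
        have e : g⁻¹ * (g * y * g⁻¹) * g⁻¹⁻¹ = y := by group
        rw [e] at hx'
        exact hx'
      · rintro ⟨y, ⟨hy, hyU⟩, rfl⟩
        refine ⟨⟨y, hy, rfl⟩, ?_⟩
        change g⁻¹ * (g * y * g⁻¹) * g⁻¹⁻¹ ∈ U
        have e : g⁻¹ * (g * y * g⁻¹) * g⁻¹⁻¹ = y := by group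
        rw [e]
        exact hyU
    rw [key, key, hU])

end Subgroups

section Stone

variable {A : Type v} [BooleanAlgebra A]

/-- The Stone space of a Boolean algebra: its points are the ultrafilters, that is, the filters
that contain exactly one of `a`, `aᶜ` for every `a`. -/
@[ext]
structure StoneSpace (A : Type v) [BooleanAlgebra A] where
  carrier : Set A
  top_mem : ⊤ ∈ carrier
  inf_mem : ∀ a ∈ carrier, ∀ b ∈ carrier, a ⊓ b ∈ carrier
  mem_of_le : ∀ a ∈ carrier, ∀ b, a ≤ b → b ∈ carrier
  compl_mem_iff : ∀ a, aᶜ ∈ carrier ↔ a ∉ carrier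

/-- The sets `{p | a ∈ p}`, for `a` in the algebra, form a base of the topology. -/
instance : TopologicalSpace (StoneSpace A) :=
  TopologicalSpace.generateFrom {s | ∃ a : A, s = {p : StoneSpace A | a ∈ p.carrier}}

/-- The image `{e a | a ∈ p}` of an ultrafilter `p` under an automorphism `e`. -/
def StoneSpace.map (e : A ≃o A) (p : StoneSpace A) : StoneSpace A where
  carrier := {a | e.symm a ∈ p.carrier}
  top_mem := by simpa using p.top_mem
  inf_mem a ha b hb := by simpa using p.inf_mem _ ha _ hb
  mem_of_le a ha b hab := p.mem_of_le _ ha _ (e.symm.monotone hab)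
  compl_mem_iff a := by
    have h : e.symm aᶜ = (e.symm a)ᶜ := map_compl' e.symm a
    simpa [h] using p.compl_mem_iff (e.symm a)

theorem StoneSpace.continuous_map (e : A ≃o A) : Continuous (StoneSpace.map e) := by
  refine continuous_generateFrom_iff.2 ?_
  rintro _ ⟨a, rfl⟩
  exact TopologicalSpace.isOpen_generateFrom_of_mem ⟨e.symm a, rfl⟩

/-- The homomorphism from the automorphisms of a Boolean algebra to the homeomorphisms of its Stone
space. -/
def stoneHom (A : Type v) [BooleanAlgebra A] : (A ≃o A) →* (StoneSpace A ≃ₜ StoneSpace A) where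
  toFun e :=
    { toFun := StoneSpace.map e
      invFun := StoneSpace.map e.symm
      left_inv := fun p => by ext a; simp [StoneSpace.map]
      right_inv := fun p => by ext a; simp [StoneSpace.map]
      continuous_toFun := StoneSpace.continuous_map e
      continuous_invFun := StoneSpace.continuous_map e.symm }
  map_one' := rfl
  map_mul' _ _ := rfl

/-- The homomorphism from the homeomorphisms of a space to the automorphisms of its Boolean algebra
of clopen subsets, `s ↦ h(s)`. -/
def clopenHom (X : Type v) [TopologicalSpace X] :
    (X ≃ₜ X) →* (TopologicalSpace.Clopens X ≃o TopologicalSpace.Clopens X) where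
  toFun h :=
    { toFun := fun s => ⟨h.symm ⁻¹' (s : Set X), s.isClopen.preimage h.symm.continuous⟩
      invFun := fun s => ⟨h ⁻¹' (s : Set X), s.isClopen.preimage h.continuous⟩
      left_inv := fun s => TopologicalSpace.Clopens.ext (by ext x; simp)
      right_inv := fun s => TopologicalSpace.Clopens.ext (by ext x; simp)
      map_rel_iff' := by
        intro s t
        change h.symm ⁻¹' (s : Set X) ⊆ h.symm ⁻¹' (t : Set X) ↔ (s : Set X) ⊆ t
        exact Set.preimage_subset_preimage_iff (by simp [h.symm.surjective.range_eq]) }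
  map_one' := rfl
  map_mul' _ _ := rfl

end Stone

section Actions

variable {G : Type u} [Group G] [TopologicalSpace G] {A : Type v} [BooleanAlgebra A]

/-- The rigid stabiliser of `a`: the elements fixing every `b ≤ aᶜ`. -/
def rist (ρ : G →* (A ≃o A)) (a : A) : Subgroup G where
  carrier := {g | ∀ b ≤ aᶜ, ρ g b = b}
  one_mem' b _ := by simp
  mul_mem' {g h} hg hh b hb := by
    rw [map_mul, RelIso.mul_apply, hh b hb, hg b hb]
  inv_mem' {g} hg b hb := by
    have h := congrArg (ρ g⁻¹) (hg b hb)
    rw [← RelIso.mul_apply, ← map_mul, inv_mul_cancel, map_one, RelIso.one_apply] at h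
    exact h.symm

/-- The action is smooth: every point stabiliser is open. -/
def IsSmooth (ρ : G →* (A ≃o A)) : Prop :=
  ∀ a : A, IsOpen {g : G | ρ g a = a}

/-- The action is weakly branch: it is smooth, and the rigid stabiliser of every nonzero element
contains an element outside the kernel of the action. -/
def IsWeaklyBranch (ρ : G →* (A ≃o A)) : Prop :=
  IsSmooth ρ ∧ ∀ a : A, a ≠ ⊥ → ∃ g ∈ rist ρ a, g ∉ ρ.ker

/-- The action is locally branch: it is weakly branch and `rist(a) rist(aᶜ)` is open for all `a`. -/
def IsLocallyBranch (ρ : G →* (A ≃o A)) : Prop :=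
  IsWeaklyBranch ρ ∧ ∀ a : A, IsOpen ((rist ρ a : Set G) * (rist ρ aᶜ : Set G))

/-- For every `a` there is a compact open subgroup `U` such that `rist_U(a) rist_U(aᶜ)` is open,
where `rist_U(a) = rist(a) ∩ U`. -/
def HasLocallyOpenRistProducts (ρ : G →* (A ≃o A)) : Prop :=
  ∀ a : A, ∃ U : Subgroup G, IsOpen (U : Set G) ∧ IsCompact (U : Set G) ∧
    IsOpen (((rist ρ a ⊓ U : Subgroup G) : Set G) * ((rist ρ aᶜ ⊓ U : Subgroup G) : Set G))

/-- The action `ρ` is equivariantly isomorphic to the action `τ` restricted to some invariant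
Boolean subalgebra. -/
def OccursOnSubalgebra {M : Type*} [BooleanAlgebra M] (ρ : G →* (A ≃o A)) (τ : G →* (M ≃o M)) :
    Prop :=
  ∃ B : BooleanSubalgebra M, (∀ g, ∀ b ∈ B, τ g b ∈ B) ∧
    ∃ e : A ≃o B, ∀ (g : G) (a : A), ((e (ρ g a) : B) : M) = τ g (e a : M)

/-- The `G`-space `X` is a `G`-equivariant quotient (continuous surjective image) of the Stone space
of `M`. -/
def IsQuotientOfStoneSpace {M : Type*} [BooleanAlgebra M] {X : Type*} [TopologicalSpace X]
    (τ : G →* (M ≃o M)) (σ : G →* (X ≃ₜ X)) : Prop :=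
  ∃ f : StoneSpace M → X, Continuous f ∧ Function.Surjective f ∧
    ∀ (g : G) (p : StoneSpace M), f (stoneHom M (τ g) p) = σ g (f p)

end Actions

end TDLC

open TDLC

/-! Local C-stability makes compact locally normal subgroups rigid. The centre of a locally normal
subgroup is compact and lies in a discrete torsion-free group, so it is finite and therefore
trivial. Trivial quasi-centre forces a discrete subgroup with open normaliser to be trivial. Hence
two compact normal subgroups of a compact open `U` whose intersection is discrete meet trivially and
commute, and inside `U` the quasi-centraliser of such a subgroup is its centraliser
(`IsLocallyCStable.mem_centralizer_of_mem_quasiCentraliser`).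

It follows that `⊥` is a pseudocomplementation on the meet-semilattice of locally normal classes
(`IsLocallyCStable.inf_eq_bot_iff`). Its closed elements form `LC(G)`, which is Boolean by
Glivenko's argument (`booleanAlgebraOfInfCompl`). The classes in `LD(G)` are those of factors of an
open product of two commuting compact subgroups, and `⊥` swaps the factors. The real work there is
closure under meets (`IsLocallyCStable.isOpenFactorPair_inf`).

A faithful weakly branch action on `A` embeds in `LC(G)` by sending `a` to the class of its rigid
stabiliser. The decisive fact is that the quasi-centraliser of `rist ρ a` is `rist ρ aᶜ`
(`IsWeaklyBranch.quasiCentraliser_rist`): if an element moves some `b ≤ a`, it moves a nonzero `c ≤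
b` off itself, and then it cannot commute with an open part of `rist ρ c`. When the products of
rigid stabilisers are locally open, these classes lie in `LD(G)`; for σ-compact `G` the open mapping
theorem supplies this. Conversely, nontrivial elements of a representative of `α` act trivially
below `α^⊥`, so a faithful action on `LC(G)` is weakly branch. Stone duality carries everything over
to profinite spaces. -/

namespace TDLC

universe u v w

/-! ### Commuting subgroups, discrete subgroups and the open mapping theorem -/

section Groups

section Algebra

variable {G : Type u} [Group G]

theorem mem_sup_iff_of_commute {K M : Subgroup G} (h : ∀ k ∈ K, ∀ m ∈ M, k * m = m * k) {x : G} :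
    x ∈ K ⊔ M ↔ ∃ k ∈ K, ∃ m ∈ M, k * m = x := by
  have e := MonoidHom.noncommCoprod_range (f := K.subtype) (g := M.subtype)
    (comm := fun k m => h k k.2 m m.2)
  rw [Subgroup.range_subtype, Subgroup.range_subtype] at e
  rw [← e]
  constructor
  · rintro ⟨⟨k, m⟩, rfl⟩
    exact ⟨k, k.2, m, m.2, rfl⟩
  · rintro ⟨k, hk, m, hm, rfl⟩
    exact ⟨(⟨k, hk⟩, ⟨m, hm⟩), rfl⟩

theorem coe_sup_of_commute {K M : Subgroup G} (h : ∀ k ∈ K, ∀ m ∈ M, k * m = m * k) :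
    ((K ⊔ M : Subgroup G) : Set G) = (K : Set G) * (M : Set G) := by
  ext x
  rw [SetLike.mem_coe, mem_sup_iff_of_commute h, Set.mem_mul]
  rfl

/-- Mutual normalisation puts every commutator of `H` with `K` into `H ⊓ K`. -/
theorem commute_of_conj_mem_of_inf_eq_bot {H K : Subgroup G}
    (hHK : ∀ k ∈ K, ∀ h ∈ H, k * h * k⁻¹ ∈ H) (hKH : ∀ h ∈ H, ∀ k ∈ K, h * k * h⁻¹ ∈ K)
    (hb : H ⊓ K = ⊥) : ∀ h ∈ H, ∀ k ∈ K, h * k = k * h := by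
  intro h hh k hk
  have h1 : h * k * h⁻¹ * k⁻¹ ∈ H ⊓ K := by
    refine ⟨?_, K.mul_mem (hKH h hh k hk) (K.inv_mem hk)⟩
    have := H.mul_mem hh (hHK k hk h⁻¹ (H.inv_mem hh))
    simpa [mul_assoc] using this
  rw [hb, Subgroup.mem_bot, mul_inv_eq_one, mul_inv_eq_iff_eq_mul] at h1
  exact h1

theorem mem_centralizer_singleton_iff {g x : G} :
    x ∈ Subgroup.centralizer {g} ↔ g * x = x * g := by
  rw [Subgroup.mem_centralizer_iff]
  simp

end Algebra

variable {G : Type u} [Group G] [TopologicalSpace G] [IsTopologicalGroup G]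

/-- With trivial quasi-centre, an element commuting with an open subgroup is trivial. -/
theorem TrivialQuasiCentre.eq_one_of_commute (hQ : TrivialQuasiCentre G) {x : G} {U : Subgroup G}
    (hU : IsOpen (U : Set G)) (h : ∀ u ∈ U, u * x = x * u) : x = 1 := by
  refine hQ x (Subgroup.isOpen_mono (H₁ := U) (fun u hu => ?_) hU)
  rw [mem_centralizer_singleton_iff]
  exact (h u hu).symm

/-- With trivial quasi-centre, a discrete subgroup with open normaliser is trivial. -/
theorem TrivialQuasiCentre.eq_bot_of_discrete (hQ : TrivialQuasiCentre G) {F : Subgroup G}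
    {V : Set G} (hV : V ∈ nhds (1 : G)) (hF : ∀ x ∈ F, x ∈ V → x = 1)
    {U : OpenSubgroup G} (hN : ∀ u ∈ U, ∀ x ∈ F, u * x * u⁻¹ ∈ F) : F = ⊥ := by
  rw [eq_bot_iff]
  intro x hx
  rw [Subgroup.mem_bot]
  refine hQ x (Subgroup.isOpen_of_mem_nhds _ (g := 1) ?_)
  -- For `y` near `1` the commutator of `y` with `x` lies in `F` and in `V`, so it is trivial. Thus
  -- `x` has open centraliser.
  have hc : ContinuousAt (fun y : G => y * x * y⁻¹ * x⁻¹) 1 := by fun_prop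
  have h1 : (fun y : G => y * x * y⁻¹ * x⁻¹) ⁻¹' V ∈ nhds (1 : G) := by
    refine hc ?_
    simpa using hV
  filter_upwards [h1, U.mem_nhds_one] with y hy hyU
  rw [SetLike.mem_coe, mem_centralizer_singleton_iff]
  have := hF _ (F.mul_mem (hN y hyU x hx) (F.inv_mem hx)) hy
  rw [mul_inv_eq_one, mul_inv_eq_iff_eq_mul] at this
  exact this.symm

/-- The centre of a locally normal subgroup is trivial. -/
theorem IsLocallyCStable.eq_one_of_mem_of_mem_centralizer [T2Space G] (hG : IsLocallyCStable G)
    {H : Subgroup G} (hH : IsLocallyNormal H) {x : G} (hx : x ∈ H)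
    (hxc : x ∈ Subgroup.centralizer (H : Set G)) : x = 1 := by
  obtain ⟨hd, ht⟩ := hG.2 H hH
  set R := quasiCentraliser ⊤ H ⊓ quasiCentraliser ⊤ (Subgroup.centralizer (H : Set G)) with hR
  -- The centre `Z` centralises both `H` and its centraliser, so it sits in the discrete
  -- torsion-free group `R`. Being compact as well, it is finite.
  let Z : Subgroup G := H ⊓ Subgroup.centralizer (H : Set G)
  have hZR : Z ≤ R := by
    rintro y ⟨hy, hyc⟩
    refine ⟨⟨trivial, ⊤, ?_⟩, ⟨trivial, ⊤, ?_⟩⟩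
    · exact Subgroup.centralizer_le (fun z hz => hz.1) hyc
    · refine Subgroup.mem_centralizer_iff.2 fun z hz => ?_
      exact (Subgroup.mem_centralizer_iff.1 hz.1 y hy).symm
  have hZc : IsCompact (Z : Set G) := hH.1.inter_right (Set.isClosed_centralizer _)
  have : CompactSpace Z := isCompact_iff_compactSpace.1 hZc
  have : DiscreteTopology Z := DiscreteTopology.of_subset (s := (R : Set G)) hd hZR
  have : Finite Z := finite_of_compact_of_discrete
  have hxZ : x ∈ Z := ⟨hx, hxc⟩
  refine ht x (hZR hxZ) ?_
  exact Submonoid.isOfFinOrder_coe.2 (isOfFinOrder_of_finite (⟨x, hxZ⟩ : Z))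

section OpenMapping

variable [LocallyCompactSpace G] [T2Space G]

/-- If the product of two commuting `σ`-compact subgroups is open, so is the product of their
intersections with an open subset. -/
theorem isOpen_mul_inter_of_isOpen_sup {K M : Subgroup G} [SigmaCompactSpace K]
    [SigmaCompactSpace M] (h : ∀ k ∈ K, ∀ m ∈ M, k * m = m * k)
    (ho : IsOpen ((K ⊔ M : Subgroup G) : Set G)) {W : Set G} (hW : IsOpen W) :
    IsOpen (((K : Set G) ∩ W) * ((M : Set G) ∩ W)) := by
  let f : K × M →* G := MonoidHom.noncommCoprod K.subtype M.subtype (fun k m => h k k.2 m m.2)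
  have hr : f.range = K ⊔ M := by
    have e := MonoidHom.noncommCoprod_range (f := K.subtype) (g := M.subtype)
      (comm := fun k m => h k k.2 m m.2)
    rw [Subgroup.range_subtype, Subgroup.range_subtype] at e
    exact e
  have hro : IsOpen (f.range : Set G) := by rw [hr]; exact ho
  have hfc : Continuous f := by
    change Continuous fun p : K × M => (p.1 : G) * (p.2 : G)
    fun_prop
  have : LocallyCompactSpace f.range := hro.locallyCompactSpace
  -- A continuous surjection from a σ-compact group onto a locally compact Hausdorff group is open.
  -- The multiplication map therefore sends the open set of pairs with both entries in `W` to an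
  -- open set.
  have h1 : IsOpenMap f.rangeRestrict :=
    MonoidHom.isOpenMap_of_sigmaCompact _ f.rangeRestrict_surjective
      (Continuous.subtype_mk hfc _)
  have h2 : IsOpenMap f := (hro.isOpenMap_subtype_val).comp h1
  have h3 : IsOpen {p : K × M | (p.1 : G) ∈ W ∧ (p.2 : G) ∈ W} :=
    (hW.preimage (by fun_prop : Continuous fun p : K × M => (p.1 : G))).inter
      (hW.preimage (by fun_prop : Continuous fun p : K × M => (p.2 : G)))
  convert h2 _ h3 using 1
  ext x
  simp only [Set.mem_mul, Set.mem_image]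
  constructor
  · rintro ⟨k, ⟨hk, hkW⟩, m, ⟨hm, hmW⟩, rfl⟩
    exact ⟨(⟨k, hk⟩, ⟨m, hm⟩), ⟨hkW, hmW⟩, rfl⟩
  · rintro ⟨⟨k, m⟩, ⟨hkW, hmW⟩, rfl⟩
    exact ⟨k, ⟨k.2, hkW⟩, m, ⟨m.2, hmW⟩, rfl⟩

theorem isOpen_inf_sup_inf {K M : Subgroup G} (hK : IsCompact (K : Set G))
    (hM : IsCompact (M : Set G)) (h : ∀ k ∈ K, ∀ m ∈ M, k * m = m * k)
    (ho : IsOpen ((K ⊔ M : Subgroup G) : Set G)) {W : Subgroup G} (hW : IsOpen (W : Set G)) :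
    IsOpen (((K ⊓ W) ⊔ (M ⊓ W) : Subgroup G) : Set G) := by
  have : CompactSpace K := isCompact_iff_compactSpace.1 hK
  have : CompactSpace M := isCompact_iff_compactSpace.1 hM
  rw [coe_sup_of_commute fun k (hk : k ∈ K ⊓ W) m (hm : m ∈ M ⊓ W) => h k hk.1 m hm.1]
  exact isOpen_mul_inter_of_isOpen_sup h ho hW

end OpenMapping

variable [LocallyCompactSpace G] [TotallyDisconnectedSpace G]

/-- Every identity neighbourhood contains a compact open subgroup. -/
theorem exists_openSubgroup_isCompact_subset {s : Set G} (hs : s ∈ nhds (1 : G)) :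
    ∃ U : OpenSubgroup G, IsCompact (U : Set G) ∧ (U : Set G) ⊆ s := by
  obtain ⟨C, hC, hCs, hCc⟩ := local_compact_nhds hs
  obtain ⟨W, hW, h1W, hWC⟩ := (loc_compact_Haus_tot_disc_of_zero_dim (H := G)).mem_nhds_iff.1 hC
  have hWcl : IsClopen W := hW
  have hWc : IsCompact W := hCc.of_isClosed_subset hWcl.isClosed hWC
  -- Van Dantzig's argument: `S` is the right stabiliser of the compact open set `W`. It lies in `W`
  -- because `1 ∈ W`, and it is open because `W * T ⊆ W` for some identity neighbourhood `T`.
  let S : Subgroup G :=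
    { carrier := {g | ∀ w, w * g ∈ W ↔ w ∈ W}
      one_mem' := fun w => by rw [mul_one]
      mul_mem' := fun {a b} ha hb w => by rw [← mul_assoc, hb, ha]
      inv_mem' := fun {a} ha w => by rw [← ha (w * a⁻¹), inv_mul_cancel_right] }
  have hSW : (S : Set G) ⊆ W := fun g hg => by
    have := (hg 1).2 h1W
    rwa [one_mul] at this
  obtain ⟨T, hT, hTW⟩ := compact_open_separated_mul_right hWc hWcl.isOpen subset_rfl
  have hSo : IsOpen (S : Set G) := by
    refine Subgroup.isOpen_of_mem_nhds S (g := 1) ?_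
    filter_upwards [hT, inv_mem_nhds_one G hT] with g hg hg' w
    refine ⟨fun hw => ?_, fun hw => hTW (Set.mul_mem_mul hw hg)⟩
    have := hTW (Set.mul_mem_mul hw (Set.mem_inv.1 hg'))
    rwa [mul_inv_cancel_right] at this
  exact ⟨⟨S, hSo⟩, hWc.of_isClosed_subset (S.isClosed_of_isOpen hSo) hSW,
    fun x hx => hCs (hWC (hSW hx))⟩

theorem exists_openSubgroup_isCompact_le (V : OpenSubgroup G) :
    ∃ U : OpenSubgroup G, IsCompact (U : Set G) ∧ U ≤ V :=
  exists_openSubgroup_isCompact_subset V.mem_nhds_one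

end Groups

/-! ### Compact normal subgroups of open subgroups -/

section NormalIn

variable {G : Type u} [Group G] [TopologicalSpace G]

/-- `H` is a compact subgroup of `U` normalised by `U`. -/
structure IsCompactNormalIn (H : Subgroup G) (U : OpenSubgroup G) : Prop where
  isCompact : IsCompact (H : Set G)
  le : ∀ h ∈ H, h ∈ U
  conj_mem : ∀ u ∈ U, ∀ h ∈ H, u * h * u⁻¹ ∈ H

variable [IsTopologicalGroup G]

theorem IsCompactNormalIn.isLocallyNormal {H : Subgroup G} {U : OpenSubgroup G}
    (h : IsCompactNormalIn H U) : IsLocallyNormal H :=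
  ⟨h.isCompact, Subgroup.isOpen_mono (H₁ := (U : Subgroup G))
    (Subgroup.le_normalizer_iff.2 h.conj_mem) U.isOpen⟩

theorem IsCompactNormalIn.inf {H K : Subgroup G} {U : OpenSubgroup G} [T2Space G]
    (hH : IsCompactNormalIn H U) (hK : IsCompactNormalIn K U) : IsCompactNormalIn (H ⊓ K) U where
  isCompact := hH.isCompact.inter hK.isCompact
  le h hh := hH.le h hh.1
  conj_mem u hu h hh := ⟨hH.conj_mem u hu h hh.1, hK.conj_mem u hu h hh.2⟩

theorem IsCompactNormalIn.inf_openSubgroup {H : Subgroup G} {V : OpenSubgroup G}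
    (hV : ∀ v ∈ V, ∀ h ∈ H, v * h * v⁻¹ ∈ H) (hH : IsCompact (H : Set G)) :
    IsCompactNormalIn (H ⊓ (V : Subgroup G)) V where
  isCompact := hH.inter_right V.isClosed
  le _ hh := hh.2
  conj_mem u hu _ hh := ⟨hV u hu _ hh.1, V.mul_mem (V.mul_mem hu hh.2) (V.inv_mem hu)⟩

theorem IsCompactNormalIn.centralizer [T2Space G] {H : Subgroup G} {U : OpenSubgroup G}
    (hU : IsCompact (U : Set G)) (h : IsCompactNormalIn H U) :
    IsCompactNormalIn (Subgroup.centralizer (H : Set G) ⊓ (U : Subgroup G)) U where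
  isCompact := hU.inter_left (Set.isClosed_centralizer _)
  le x hx := hx.2
  conj_mem u hu x hx := by
    refine ⟨Subgroup.mem_centralizer_iff.2 fun y hy => ?_,
      U.mul_mem (U.mul_mem hu hx.2) (U.inv_mem hu)⟩
    have h1 : u⁻¹ * y * u⁻¹⁻¹ ∈ H := h.conj_mem u⁻¹ (U.inv_mem hu) y hy
    have h2 := Subgroup.mem_centralizer_iff.1 hx.1 _ h1
    rw [inv_inv] at h2
    calc y * (u * x * u⁻¹) = u * (u⁻¹ * y * u * x) * u⁻¹ := by group
      _ = u * (x * (u⁻¹ * y * u)) * u⁻¹ := by rw [h2]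
      _ = u * x * u⁻¹ * y := by group

theorem IsLocallyNormal.exists_openSubgroup {H : Subgroup G} (hH : IsLocallyNormal H) :
    ∃ N : OpenSubgroup G, ∀ n ∈ N, ∀ h ∈ H, n * h * n⁻¹ ∈ H :=
  ⟨⟨_, hH.2⟩, Subgroup.le_normalizer_iff.1 le_rfl⟩

variable [T2Space G]

/-- Such an `H` is discrete and normalised by `U`. This is how a local statement about normal
subgroups of `U` becomes an exact one. -/
theorem IsLocallyCStable.eq_bot_of_inf_eq_bot (hG : IsLocallyCStable G) {H : Subgroup G}
    {U V : OpenSubgroup G} (hH : IsCompactNormalIn H U) (h : ∀ x ∈ H, x ∈ V → x = 1) : H = ⊥ :=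
  hG.1.eq_bot_of_discrete (V := (V : Set G)) V.mem_nhds_one h (U := U) hH.conj_mem

/-- A common element is central in `H`, and that centre is trivial. -/
theorem IsLocallyCStable.inf_eq_bot_of_commute (hG : IsLocallyCStable G) {H K : Subgroup G}
    {U : OpenSubgroup G} (hH : IsCompactNormalIn H U)
    (h : ∀ x ∈ H, ∀ y ∈ K, x * y = y * x) : H ⊓ K = ⊥ := by
  rw [eq_bot_iff]
  intro x hx
  exact hG.eq_one_of_mem_of_mem_centralizer hH.isLocallyNormal hx.1
    (Subgroup.mem_centralizer_iff.2 fun y hy => h y hy x hx.2)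

theorem IsCompactNormalIn.commute_of_inf_eq_bot {H K : Subgroup G} {U : OpenSubgroup G}
    (hH : IsCompactNormalIn H U) (hK : IsCompactNormalIn K U) (hb : H ⊓ K = ⊥) :
    ∀ x ∈ H, ∀ y ∈ K, x * y = y * x :=
  commute_of_conj_mem_of_inf_eq_bot (fun k hk h hh => hH.conj_mem k (hK.le k hk) h hh)
    (fun h hh k hk => hK.conj_mem h (hH.le h hh) k hk) hb

variable [LocallyCompactSpace G] [TotallyDisconnectedSpace G]

/-- A compact open subgroup has arbitrarily small open normal subgroups. -/
theorem exists_openSubgroup_normalIn {U : OpenSubgroup G} (hU : IsCompact (U : Set G))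
    (V : OpenSubgroup G) : ∃ W : OpenSubgroup G, W ≤ V ∧ IsCompactNormalIn (W : Subgroup G) U := by
  have : CompactSpace (U : Subgroup G) := isCompact_iff_compactSpace.1 hU
  have hV : IsOpen ((↑) ⁻¹' (V : Set G) : Set (U : Subgroup G)) :=
    V.isOpen.preimage continuous_subtype_val
  obtain ⟨N, hN⟩ := ProfiniteGrp.exist_openNormalSubgroup_sub_open_nhds_of_one hV V.one_mem
  have hNo : IsOpen ((N.toSubgroup.map (U : Subgroup G).subtype : Subgroup G) : Set G) :=
    U.isOpen.isOpenMap_subtype_val _ N.isOpen'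
  have hNU : ∀ h ∈ N.toSubgroup.map (U : Subgroup G).subtype, h ∈ U := by
    rintro _ ⟨x, _, rfl⟩
    exact x.2
  refine ⟨⟨_, hNo⟩, ?_, hU.of_isClosed_subset (Subgroup.isClosed_of_isOpen _ hNo) hNU, hNU, ?_⟩
  · rintro _ ⟨x, hx, rfl⟩
    exact hN hx
  · rintro u hu _ ⟨x, hx, rfl⟩
    exact ⟨⟨u, hu⟩ * x * ⟨u, hu⟩⁻¹, N.isNormal'.conj_mem x hx _, rfl⟩

/-- The quasi-centraliser of a normal subgroup of a compact open subgroup `U` meets `U` in the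
centraliser. -/
theorem IsLocallyCStable.mem_centralizer_of_mem_quasiCentraliser (hG : IsLocallyCStable G)
    {H : Subgroup G} {U : OpenSubgroup G} (hU : IsCompact (U : Set G))
    (hH : IsCompactNormalIn H U) {x : G} (hx : x ∈ quasiCentraliser ⊤ H) (hxU : x ∈ U) :
    x ∈ Subgroup.centralizer (H : Set G) := by
  obtain ⟨-, V, hV⟩ := hx
  -- Shrinking `V` to a `W` normal in `U` makes `H ⊓ W` and its centraliser in `U` normal in `U`.
  -- That centraliser contains `x`. It meets `H ⊓ W` in the centre of `H ⊓ W`, which is trivial, so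
  -- it meets `H` discretely, hence trivially, and so commutes with all of `H`.
  obtain ⟨W, hWV, hW⟩ := exists_openSubgroup_normalIn hU V
  have hHW : IsCompactNormalIn (H ⊓ (W : Subgroup G)) U := hH.inf hW
  have hC := hHW.centralizer hU
  have hb : H ⊓ (Subgroup.centralizer ((H ⊓ (W : Subgroup G) : Subgroup G) : Set G) ⊓
      (U : Subgroup G)) = ⊥ := by
    refine hG.eq_bot_of_inf_eq_bot (hH.inf hC) (V := W) fun y hy hyW => ?_
    exact hG.eq_one_of_mem_of_mem_centralizer hHW.isLocallyNormal ⟨hy.1, hyW⟩ hy.2.1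
  have hxC : x ∈ Subgroup.centralizer ((H ⊓ (W : Subgroup G) : Subgroup G) : Set G) ⊓
      (U : Subgroup G) :=
    ⟨Subgroup.centralizer_le (fun y (hy : y ∈ H ⊓ (W : Subgroup G)) =>
      (⟨hy.1, hWV hy.2⟩ : y ∈ H ⊓ (V : Subgroup G))) hV, hxU⟩
  exact Subgroup.mem_centralizer_iff.2 fun h hh => hH.commute_of_inf_eq_bot hC hb h hh x hxC

end NormalIn

/-! ### Order, meets, conjugation and `⊥` on local classes -/

section Order

variable {G : Type u} [Group G] [TopologicalSpace G]

theorem LocalClass.mk_le_mk {H K : Subgroup G} :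
    LocalClass.mk H ≤ LocalClass.mk K ↔ ∃ U : OpenSubgroup G, H ⊓ (U : Subgroup G) ≤ K :=
  Iff.rfl

theorem LocalClass.mk_mono {H K : Subgroup G} (h : H ≤ K) : LocalClass.mk H ≤ LocalClass.mk K :=
  ⟨⊤, inf_le_left.trans h⟩

theorem LocalClass.mk_inf_openSubgroup (H : Subgroup G) (U : OpenSubgroup G) :
    LocalClass.mk (H ⊓ (U : Subgroup G)) = LocalClass.mk H :=
  le_antisymm (mk_mono inf_le_left) ⟨U, le_rfl⟩

theorem LocalClass.le_mk_inf {α : LocalClass G} {H K : Subgroup G} :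
    α ≤ LocalClass.mk (H ⊓ K) ↔ α ≤ LocalClass.mk H ∧ α ≤ LocalClass.mk K := by
  refine ⟨fun h => ⟨h.trans (mk_mono inf_le_left), h.trans (mk_mono inf_le_right)⟩, ?_⟩
  induction α using Quotient.inductionOn with | _ L
  rintro ⟨⟨U, hU⟩, V, hV⟩
  refine ⟨U ⊓ V, fun x hx => ?_⟩
  simp only [OpenSubgroup.toSubgroup_inf, Subgroup.mem_inf] at hx
  exact ⟨hU ⟨hx.1, hx.2.1⟩, hV ⟨hx.1, hx.2.2⟩⟩

/-- The class of the trivial subgroup is the least local class. -/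
instance : OrderBot (LocalClass G) where
  bot := LocalClass.mk ⊥
  bot_le := by
    rintro ⟨H⟩
    exact LocalClass.mk_mono bot_le

/-- The class of an intersection is the infimum of the classes. -/
instance : SemilatticeInf (LocalClass G) where
  inf := Quotient.map₂ (fun H K => H ⊓ K) (by
    rintro H H' ⟨U, hU⟩ K K' ⟨V, hV⟩
    refine ⟨U ⊓ V, ?_⟩
    rw [OpenSubgroup.toSubgroup_inf, inf_inf_inf_comm, hU, hV, inf_inf_inf_comm])
  inf_le_left := by
    rintro ⟨H⟩ ⟨K⟩
    exact LocalClass.mk_mono inf_le_left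
  inf_le_right := by
    rintro ⟨H⟩ ⟨K⟩
    exact LocalClass.mk_mono inf_le_right
  le_inf := by
    rintro α ⟨H⟩ ⟨K⟩ hH hK
    exact LocalClass.le_mk_inf.2 ⟨hH, hK⟩

theorem LocalClass.mk_inf_mk (H K : Subgroup G) :
    LocalClass.mk H ⊓ LocalClass.mk K = LocalClass.mk (H ⊓ K) := rfl

theorem LocalClass.perp_mk (H : Subgroup G) :
    (LocalClass.mk H).perp = LocalClass.mk (quasiCentraliser ⊤ H) := rfl

theorem LocalClass.mk_eq_bot_iff {H : Subgroup G} :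
    LocalClass.mk H = ⊥ ↔ ∃ V : OpenSubgroup G, ∀ x ∈ H, x ∈ V → x = 1 := by
  rw [← le_bot_iff]
  exact exists_congr fun V => ⟨fun h x hx hV => h ⟨hx, hV⟩, fun h x hx => h x hx.1 hx.2⟩

variable [IsTopologicalGroup G]

theorem LocalClass.conj_mk (g : G) (H : Subgroup G) :
    (LocalClass.mk H).conj g = LocalClass.mk (H.map (MulAut.conj g).toMonoidHom) := rfl

theorem LocalClass.conj_one (α : LocalClass G) : α.conj 1 = α := by
  induction α using Quotient.inductionOn with | _ H
  change LocalClass.mk _ = LocalClass.mk _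
  congr 1
  ext x
  simp

theorem LocalClass.conj_mul (g h : G) (α : LocalClass G) :
    α.conj (g * h) = (α.conj h).conj g := by
  induction α using Quotient.inductionOn with | _ H
  change LocalClass.mk _ = LocalClass.mk _
  rw [Subgroup.map_map]
  congr 2
  ext x
  simp [mul_assoc]

theorem mem_map_conj_iff {g x : G} {H : Subgroup G} :
    x ∈ H.map (MulAut.conj g).toMonoidHom ↔ g⁻¹ * x * g ∈ H := by
  constructor
  · rintro ⟨y, hy, rfl⟩
    have e : g⁻¹ * (g * y * g⁻¹) * g = y := by group
    change g⁻¹ * (g * y * g⁻¹) * g ∈ H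
    rwa [e]
  · intro h
    refine ⟨_, h, ?_⟩
    change g * (g⁻¹ * x * g) * g⁻¹ = x
    group

/-- The conjugate of an open subgroup. -/
theorem exists_openSubgroup_conj (g : G) (U : OpenSubgroup G) :
    ∃ V : OpenSubgroup G, ∀ x, x ∈ V ↔ g⁻¹ * x * g ∈ U := by
  refine ⟨U.comap (MulAut.conj g⁻¹).toMonoidHom ?_, fun x => ?_⟩
  · change Continuous fun x => g⁻¹ * x * g⁻¹⁻¹
    fun_prop
  · change g⁻¹ * x * g⁻¹⁻¹ ∈ U ↔ _
    rw [inv_inv]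

theorem LocalClass.conj_mono (g : G) {α β : LocalClass G} (h : α ≤ β) : α.conj g ≤ β.conj g := by
  induction α using Quotient.inductionOn with | _ H
  induction β using Quotient.inductionOn with | _ K
  obtain ⟨U, hU⟩ := h
  obtain ⟨V, hV⟩ := exists_openSubgroup_conj g U
  refine ⟨V, fun x hx => ?_⟩
  exact mem_map_conj_iff.2 (hU ⟨mem_map_conj_iff.1 hx.1, (hV x).1 hx.2⟩)

theorem quasiCentraliser_map_conj_le (g : G) (H : Subgroup G) :
    (quasiCentraliser ⊤ H).map (MulAut.conj g).toMonoidHom ≤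
      quasiCentraliser ⊤ (H.map (MulAut.conj g).toMonoidHom) := by
  rintro x hx
  obtain ⟨-, U, hU⟩ := mem_map_conj_iff.1 hx
  obtain ⟨V, hV⟩ := exists_openSubgroup_conj g U
  refine ⟨trivial, V, Subgroup.mem_centralizer_iff.2 fun y hy => ?_⟩
  have h := Subgroup.mem_centralizer_iff.1 hU (g⁻¹ * y * g)
    ⟨mem_map_conj_iff.1 hy.1, (hV y).1 hy.2⟩
  calc y * x = g * (g⁻¹ * y * g * (g⁻¹ * x * g)) * g⁻¹ := by group
    _ = g * (g⁻¹ * x * g * (g⁻¹ * y * g)) * g⁻¹ := by rw [h]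
    _ = x * y := by group

theorem LocalClass.perp_conj (g : G) (α : LocalClass G) : (α.conj g).perp = α.perp.conj g := by
  have key : ∀ (g : G) (α : LocalClass G), α.perp.conj g ≤ (α.conj g).perp := by
    intro g α
    induction α using Quotient.inductionOn with | _ H
    exact LocalClass.mk_mono (quasiCentraliser_map_conj_le g H)
  refine le_antisymm ?_ (key g α)
  -- The reverse inequality is `key` for `g⁻¹`, conjugated back by `g`.
  have h := LocalClass.conj_mono g (key g⁻¹ (α.conj g))
  rwa [← LocalClass.conj_mul, ← LocalClass.conj_mul, mul_inv_cancel, inv_mul_cancel,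
    LocalClass.conj_one, LocalClass.conj_one] at h

theorem LocalClass.perp_anti {α β : LocalClass G} (h : α ≤ β) : β.perp ≤ α.perp := by
  induction α using Quotient.inductionOn with | _ H
  induction β using Quotient.inductionOn with | _ K
  obtain ⟨U, hU⟩ := h
  refine LocalClass.mk_mono ?_
  rintro x ⟨-, V, hV⟩
  refine ⟨trivial, U ⊓ V, Subgroup.centralizer_le (fun y hy => ?_) hV⟩
  exact ⟨hU ⟨hy.1, hy.2.1⟩, hy.2.2⟩

end Order

/-! ### Pseudocomplementation on the structure lattice -/

section StructureLattice

variable {G : Type u} [Group G] [TopologicalSpace G] [IsTopologicalGroup G]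

theorem IsLocallyNormal.map_conj {H : Subgroup G} (hH : IsLocallyNormal H) (g : G) :
    IsLocallyNormal (H.map (MulAut.conj g).toMonoidHom) := by
  obtain ⟨N, hN⟩ := hH.exists_openSubgroup
  obtain ⟨V, hV⟩ := exists_openSubgroup_conj g N
  constructor
  · rw [Subgroup.coe_map]
    refine hH.1.image ?_
    change Continuous fun x => g * x * g⁻¹
    fun_prop
  · refine Subgroup.isOpen_mono (H₁ := (V : Subgroup G))
      (Subgroup.le_normalizer_iff.2 fun v hv h hh => ?_) V.isOpen
    rw [mem_map_conj_iff] at hh ⊢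
    have := hN _ ((hV v).1 hv) _ hh
    convert this using 1
    group

theorem conj_mem_structureLattice {α : LocalClass G} (hα : α ∈ structureLattice G) (g : G) :
    α.conj g ∈ structureLattice G := by
  obtain ⟨H, hH, rfl⟩ := hα
  exact ⟨_, hH.map_conj g, rfl⟩

theorem bot_mem_structureLattice : (⊥ : LocalClass G) ∈ structureLattice G := by
  refine ⟨⊥, ⟨?_, ?_⟩, rfl⟩
  · rw [Subgroup.coe_bot]
    exact isCompact_singleton
  · refine Subgroup.isOpen_mono (H₁ := (⊤ : Subgroup G))
      (Subgroup.le_normalizer_iff.2 fun v _ h hh => ?_) isOpen_univ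
    rw [Subgroup.mem_bot] at hh ⊢
    rw [hh]
    group

variable [LocallyCompactSpace G] [TotallyDisconnectedSpace G]

/-- Two locally normal classes are represented by normal subgroups of a common compact open
subgroup. -/
theorem exists_isCompactNormalIn_pair {H K : Subgroup G} (hH : IsLocallyNormal H)
    (hK : IsLocallyNormal K) : ∃ U : OpenSubgroup G, IsCompact (U : Set G) ∧
      IsCompactNormalIn (H ⊓ (U : Subgroup G)) U ∧ IsCompactNormalIn (K ⊓ (U : Subgroup G)) U := by
  obtain ⟨M, hM⟩ := hH.exists_openSubgroup
  obtain ⟨N, hN⟩ := hK.exists_openSubgroup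
  obtain ⟨U, hU, hUV⟩ := exists_openSubgroup_isCompact_le (M ⊓ N)
  exact ⟨U, hU,
    IsCompactNormalIn.inf_openSubgroup (fun v hv => hM v (hUV hv).1) hH.1,
    IsCompactNormalIn.inf_openSubgroup (fun v hv => hN v (hUV hv).2) hK.1⟩

theorem inf_mem_structureLattice {α β : LocalClass G} (hα : α ∈ structureLattice G)
    (hβ : β ∈ structureLattice G) : α ⊓ β ∈ structureLattice G := by
  obtain ⟨H, hH, rfl⟩ := hα
  obtain ⟨K, hK, rfl⟩ := hβ
  obtain ⟨U, hU, hHU, hKU⟩ := exists_isCompactNormalIn_pair hH hK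
  refine ⟨_, (hHU.inf hKU).isLocallyNormal, ?_⟩
  rw [← LocalClass.mk_inf_mk, LocalClass.mk_inf_openSubgroup, LocalClass.mk_inf_openSubgroup]

/-- The quasi-centraliser need not be compact; this provides a compact representative of `⊥`, again
normal in `U`. -/
theorem IsLocallyCStable.perp_mk_eq (hG : IsLocallyCStable G) {H : Subgroup G}
    {U : OpenSubgroup G} (hU : IsCompact (U : Set G)) (hH : IsCompactNormalIn H U) :
    (LocalClass.mk H).perp =
      LocalClass.mk (Subgroup.centralizer (H : Set G) ⊓ (U : Subgroup G)) := by
  rw [LocalClass.perp_mk]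
  refine le_antisymm (LocalClass.mk_le_mk.2 ⟨U, fun x hx => ?_⟩) (LocalClass.mk_mono fun x hx => ?_)
  · exact ⟨hG.mem_centralizer_of_mem_quasiCentraliser hU hH hx.1 hx.2, hx.2⟩
  · exact ⟨trivial, ⊤, Subgroup.centralizer_le (fun y hy => hy.1) hx.1⟩

theorem IsLocallyCStable.perp_mem_structureLattice (hG : IsLocallyCStable G) {α : LocalClass G}
    (hα : α ∈ structureLattice G) : α.perp ∈ structureLattice G := by
  obtain ⟨H, hH, rfl⟩ := hα
  obtain ⟨U, hU, hHU, -⟩ := exists_isCompactNormalIn_pair hH hH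
  rw [← LocalClass.mk_inf_openSubgroup H U, hG.perp_mk_eq hU hHU]
  exact ⟨_, (hHU.centralizer hU).isLocallyNormal, rfl⟩

/-- `⊥` is a pseudocomplementation on the structure lattice. -/
theorem IsLocallyCStable.inf_eq_bot_iff (hG : IsLocallyCStable G) {α β : LocalClass G}
    (hα : α ∈ structureLattice G) (hβ : β ∈ structureLattice G) :
    α ⊓ β = ⊥ ↔ α ≤ β.perp := by
  obtain ⟨H, hH, rfl⟩ := hα
  obtain ⟨K, hK, rfl⟩ := hβ
  obtain ⟨U, hU, hHU, hKU⟩ := exists_isCompactNormalIn_pair hH hK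
  rw [← LocalClass.mk_inf_openSubgroup H U, ← LocalClass.mk_inf_openSubgroup K U,
    hG.perp_mk_eq hU hKU, LocalClass.mk_inf_mk, LocalClass.mk_eq_bot_iff]
  constructor
  · rintro ⟨V, hV⟩
    -- The intersection is normal in `U` and discrete, hence trivial, so the two subgroups commute.
    have hb := hG.eq_bot_of_inf_eq_bot (hHU.inf hKU) hV
    refine LocalClass.mk_mono fun x hx => ⟨Subgroup.mem_centralizer_iff.2 fun y hy => ?_, hx.2⟩
    exact (hHU.commute_of_inf_eq_bot hKU hb x hx y hy).symm
  · rintro ⟨V, hV⟩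
    exact ⟨V, fun x hx hxV =>
      hG.eq_one_of_mem_of_mem_centralizer hKU.isLocallyNormal hx.2 (hV ⟨hx.1, hxV⟩).1⟩

theorem IsLocallyCStable.le_perp_perp (hG : IsLocallyCStable G) {α : LocalClass G}
    (hα : α ∈ structureLattice G) : α ≤ α.perp.perp := by
  have hp := hG.perp_mem_structureLattice hα
  rw [← hG.inf_eq_bot_iff hα hp, inf_comm, hG.inf_eq_bot_iff hp hα]

theorem IsLocallyCStable.perp_perp_perp (hG : IsLocallyCStable G) {α : LocalClass G}
    (hα : α ∈ structureLattice G) : α.perp.perp.perp = α.perp :=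
  le_antisymm (LocalClass.perp_anti (hG.le_perp_perp hα))
    (hG.le_perp_perp (hG.perp_mem_structureLattice hα))

end StructureLattice

/-! ### Open products of commuting compact subgroups and decomposition classes -/

section Decomposition

variable {G : Type u} [Group G] [TopologicalSpace G]

/-- `K` and `M` are commuting compact subgroups whose product is open. -/
structure IsOpenFactorPair (K M : Subgroup G) : Prop where
  left : IsCompact (K : Set G)
  right : IsCompact (M : Set G)
  commute : ∀ k ∈ K, ∀ m ∈ M, k * m = m * k
  isOpen : IsOpen ((K ⊔ M : Subgroup G) : Set G)

namespace IsOpenFactorPair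

variable {K M : Subgroup G}

theorem symm (h : IsOpenFactorPair K M) : IsOpenFactorPair M K where
  left := h.right
  right := h.left
  commute m hm k hk := (h.commute k hk m hm).symm
  isOpen := by rw [sup_comm]; exact h.isOpen

/-- The product of the two factors. -/
def prod (h : IsOpenFactorPair K M) : OpenSubgroup G := ⟨K ⊔ M, h.isOpen⟩

theorem mem_prod (h : IsOpenFactorPair K M) {x : G} :
    x ∈ h.prod ↔ ∃ k ∈ K, ∃ m ∈ M, k * m = x :=
  mem_sup_iff_of_commute h.commute

variable [IsTopologicalGroup G]

theorem isCompact_prod (h : IsOpenFactorPair K M) : IsCompact (h.prod : Set G) := by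
  have e : (h.prod : Set G) = (K : Set G) * (M : Set G) := coe_sup_of_commute h.commute
  rw [e]
  exact h.left.mul h.right

theorem isCompactNormalIn (h : IsOpenFactorPair K M) : IsCompactNormalIn K h.prod where
  isCompact := h.left
  le x hx := (le_sup_left : K ≤ K ⊔ M) hx
  conj_mem u hu x hx := by
    obtain ⟨k, hk, m, hm, rfl⟩ := h.mem_prod.1 hu
    have e : k * m * x * (k * m)⁻¹ = k * x * k⁻¹ := by
      rw [mul_assoc k m x, ← h.commute x hx m hm]
      group
    rw [e]
    exact K.mul_mem (K.mul_mem hk hx) (K.inv_mem hk)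

theorem map_conj (h : IsOpenFactorPair K M) (g : G) :
    IsOpenFactorPair (K.map (MulAut.conj g).toMonoidHom) (M.map (MulAut.conj g).toMonoidHom) := by
  have hc : Continuous (MulAut.conj g).toMonoidHom := by
    change Continuous fun x => g * x * g⁻¹
    fun_prop
  refine ⟨h.left.image hc, h.right.image hc, ?_, ?_⟩
  · rintro _ ⟨k, hk, rfl⟩ _ ⟨m, hm, rfl⟩
    rw [← map_mul, h.commute k hk m hm, map_mul]
  · rw [← Subgroup.map_sup]
    obtain ⟨V, hV⟩ := exists_openSubgroup_conj g h.prod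
    convert V.isOpen using 1
    ext x
    exact mem_map_conj_iff.trans (hV x).symm

variable [T2Space G]

theorem inf_eq_bot (h : IsOpenFactorPair K M) (hG : IsLocallyCStable G) : K ⊓ M = ⊥ :=
  hG.inf_eq_bot_of_commute h.isCompactNormalIn h.commute

/-- If `k * m` centralises `K`, then so does `k`, which is then central in `K` and equals `1`. -/
theorem centralizer_inf_prod (h : IsOpenFactorPair K M) (hG : IsLocallyCStable G) :
    Subgroup.centralizer (K : Set G) ⊓ (h.prod : Subgroup G) = M := by
  refine le_antisymm ?_ fun m hm => ⟨?_, (le_sup_right : M ≤ K ⊔ M) hm⟩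
  · rintro x ⟨hx, hxU⟩
    obtain ⟨k, hk, m, hm, rfl⟩ := h.mem_prod.1 hxU
    have hk1 : k = 1 := by
      refine hG.eq_one_of_mem_of_mem_centralizer h.isCompactNormalIn.isLocallyNormal hk
        (Subgroup.mem_centralizer_iff.2 fun y hy => ?_)
      have h1 := Subgroup.mem_centralizer_iff.1 hx y hy
      have h2 := h.commute y hy m hm
      apply mul_right_cancel (b := m)
      rw [mul_assoc, h1, mul_assoc, mul_assoc, h2]
    rw [hk1, one_mul]
    exact hm
  · exact Subgroup.mem_centralizer_iff.2 fun k hk => h.commute k hk m hm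

variable [LocallyCompactSpace G] [TotallyDisconnectedSpace G]

theorem perp_mk (h : IsOpenFactorPair K M) (hG : IsLocallyCStable G) :
    (LocalClass.mk K).perp = LocalClass.mk M := by
  rw [hG.perp_mk_eq h.isCompact_prod h.isCompactNormalIn, h.centralizer_inf_prod hG]

theorem inf_openSubgroup (h : IsOpenFactorPair K M) (U : OpenSubgroup G) :
    IsOpenFactorPair (K ⊓ (U : Subgroup G)) (M ⊓ (U : Subgroup G)) where
  left := h.left.inter_right U.isClosed
  right := h.right.inter_right U.isClosed
  commute k hk m hm := h.commute k hk.1 m hm.1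
  isOpen := isOpen_inf_sup_inf h.left h.right h.commute h.isOpen U.isOpen

end IsOpenFactorPair

/-- A closed subgroup of finite index in an open subgroup is open. -/
theorem isOpen_of_relIndex_ne_zero [IsTopologicalGroup G] {L U : Subgroup G}
    (hU : IsOpen (U : Set G)) (hL : IsClosed (L : Set G)) (hLU : L ≤ U)
    (hi : L.relIndex U ≠ 0) : IsOpen (L : Set G) := by
  have : (L.subgroupOf U).FiniteIndex := ⟨hi⟩
  have h1 : IsOpen ((L.subgroupOf U : Subgroup U) : Set U) :=
    Subgroup.isOpen_of_isClosed_of_finiteIndex _ (hL.preimage continuous_subtype_val)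
  have h2 := hU.isOpenMap_subtype_val _ h1
  convert h2 using 1
  ext x
  exact ⟨fun hx => ⟨⟨x, hLU hx⟩, hx, rfl⟩, fun ⟨y, hy, e⟩ => e ▸ hy⟩

/-- The classes that make up the local decomposition lattice. -/
def IsDecompositionClass (γ : LocalClass G) : Prop :=
  ∃ K U : Subgroup G, IsLocallyNormal K ∧ IsOpen (U : Set G) ∧
    IsCompact (U : Set G) ∧ IsAlmostDirectFactor K U ∧ γ = LocalClass.mk K

/-- The classes that make up the centraliser lattice. -/
def IsCentraliserClass (γ : LocalClass G) : Prop :=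
  ∃ α ∈ structureLattice G, γ = α.perp

variable [IsTopologicalGroup G] [LocallyCompactSpace G] [TotallyDisconnectedSpace G]

/-- `IsDirectFactor` puts no topological condition on the complement `M`. Since `K` has trivial
centre, `M` is the centraliser of `K` in the product, so it is closed in a compact group. The
product is open, being closed of finite index in an open subgroup. -/
theorem IsLocallyCStable.isDecompositionClass_iff (hG : IsLocallyCStable G) {γ : LocalClass G} :
    IsDecompositionClass γ ↔ ∃ K M : Subgroup G, IsOpenFactorPair K M ∧ γ = LocalClass.mk K := by
  constructor
  · rintro ⟨K, U, hK, hUo, hUc, ⟨L, hLU, hLc, hi, M, hcomm, -, rfl⟩, rfl⟩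
    have hLo := isOpen_of_relIndex_ne_zero hUo hLc hLU hi
    have hM : M = Subgroup.centralizer (K : Set G) ⊓ (K ⊔ M) := by
      refine le_antisymm (fun m hm =>
        ⟨Subgroup.mem_centralizer_iff.2 fun k hk => hcomm k hk m hm,
          (le_sup_right : M ≤ K ⊔ M) hm⟩) ?_
      rintro x ⟨hx, hxL⟩
      obtain ⟨k, hk, m, hm, rfl⟩ := (mem_sup_iff_of_commute hcomm).1 hxL
      have hk1 : k = 1 := by
        refine hG.eq_one_of_mem_of_mem_centralizer hK hk
          (Subgroup.mem_centralizer_iff.2 fun y hy => ?_)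
        have h1 := Subgroup.mem_centralizer_iff.1 hx y hy
        have h2 := hcomm y hy m hm
        apply mul_right_cancel (b := m)
        rw [mul_assoc, h1, mul_assoc, mul_assoc, h2]
      rw [hk1, one_mul]
      exact hm
    refine ⟨K, M, ⟨hK.1, ?_, hcomm, hLo⟩, rfl⟩
    rw [hM]
    exact (hUc.of_isClosed_subset hLc hLU).inter_left (Set.isClosed_centralizer _)
  · rintro ⟨K, M, h, rfl⟩
    refine ⟨K, K ⊔ M, h.isCompactNormalIn.isLocallyNormal, h.isOpen, h.isCompact_prod,
      ⟨K ⊔ M, le_rfl, Subgroup.isClosed_of_isOpen _ h.isOpen, ?_, M, h.commute, h.inf_eq_bot hG,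
        rfl⟩, rfl⟩
    rw [Subgroup.relIndex_self]
    exact one_ne_zero

/-- If `K` and `M` meet trivially and `M` is normal in `U`, an element of `M` is trivial as soon as
it commutes modulo `K` with two normal subgroups of `U` whose product is open. -/
theorem IsLocallyCStable.eq_one_of_commutator_mem (hG : IsLocallyCStable G)
    {K M A B : Subgroup G} {U : OpenSubgroup G} (hM : IsCompactNormalIn M U)
    (hb : K ⊓ M = ⊥) (hAB : IsOpenFactorPair A B)
    (hA : IsCompactNormalIn A U) (hB : IsCompactNormalIn B U) {m : G} (hm : m ∈ M)
    (h1 : ∀ x ∈ A, m * x * m⁻¹ * x⁻¹ ∈ K) (h2 : ∀ x ∈ B, m * x * m⁻¹ * x⁻¹ ∈ K) : m = 1 := by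
  have key : ∀ x ∈ U, m * x * m⁻¹ * x⁻¹ ∈ K → x * m = m * x := by
    intro x hx hxK
    have h3 : m * x * m⁻¹ * x⁻¹ ∈ K ⊓ M := by
      refine ⟨hxK, ?_⟩
      have := M.mul_mem hm (hM.conj_mem x hx m⁻¹ (M.inv_mem hm))
      simpa [mul_assoc] using this
    rw [hb, Subgroup.mem_bot, mul_inv_eq_one, mul_inv_eq_iff_eq_mul] at h3
    exact h3.symm
  refine hG.1.eq_one_of_commute hAB.isOpen fun x hx => ?_
  obtain ⟨a, ha, b, hb, rfl⟩ := hAB.mem_prod.1 hx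
  rw [mul_assoc, key b (hB.le b hb) (h2 b hb), ← mul_assoc, key a (hA.le a ha) (h1 a ha),
    mul_assoc]

/-- The centraliser `C` of `K₁ ⊓ K₂` in `U` contains `M₁` and `M₂`, so it is enough to see that an
open part of `K₁` lies in `(K₁ ⊓ K₂) ⊔ C`. An element of that part is `c * d` with `c ∈ K₂`, `d ∈
M₂` and `c = k * m` in `K₁ ⊔ M₁`. The component `m` commutes modulo `K₁` with both `K₂` and `M₂`,
which forces `m = 1` and `c ∈ K₁ ⊓ K₂`. -/
theorem IsLocallyCStable.isOpenFactorPair_inf (hG : IsLocallyCStable G)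
    {K₁ M₁ K₂ M₂ : Subgroup G} {U : OpenSubgroup G} (hU : IsCompact (U : Set G))
    (h₁ : IsOpenFactorPair K₁ M₁) (h₂ : IsOpenFactorPair K₂ M₂)
    (hK₁ : IsCompactNormalIn K₁ U) (hM₁ : IsCompactNormalIn M₁ U)
    (hK₂ : IsCompactNormalIn K₂ U) (hM₂ : IsCompactNormalIn M₂ U) :
    IsOpenFactorPair (K₁ ⊓ K₂)
      (Subgroup.centralizer ((K₁ ⊓ K₂ : Subgroup G) : Set G) ⊓ (U : Subgroup G)) := by
  have hK := hK₁.inf hK₂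
  have hC := hK.centralizer hU
  set C := Subgroup.centralizer ((K₁ ⊓ K₂ : Subgroup G) : Set G) ⊓ (U : Subgroup G) with hCdef
  refine ⟨hK.isCompact, hC.isCompact,
    fun k hk m hm => Subgroup.mem_centralizer_iff.1 hm.1 k hk, ?_⟩
  have hM₁C : M₁ ≤ C := fun m hm =>
    ⟨Subgroup.mem_centralizer_iff.2 fun k hk => h₁.commute k hk.1 m hm, hM₁.le m hm⟩
  have hM₂C : M₂ ≤ C := fun m hm =>
    ⟨Subgroup.mem_centralizer_iff.2 fun k hk => h₂.commute k hk.2 m hm, hM₂.le m hm⟩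
  -- Cutting `K₂` down to the first product lets its elements be decomposed along `K₁` and `M₁`,
  -- while the product with `M₂` stays open.
  have hW : IsOpen (((K₂ ⊓ (h₁.prod : Subgroup G)) ⊔ M₂ : Subgroup G) : Set G) :=
    Subgroup.isOpen_mono (sup_le_sup_left inf_le_left _) (h₂.inf_openSubgroup h₁.prod).isOpen
  have hsub : K₁ ⊓ ((K₂ ⊓ (h₁.prod : Subgroup G)) ⊔ M₂) ≤ (K₁ ⊓ K₂) ⊔ C := by
    rintro a ⟨ha, haW⟩
    obtain ⟨c, ⟨hc, hcL⟩, d, hd, rfl⟩ :=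
      (mem_sup_iff_of_commute fun k (hk : k ∈ K₂ ⊓ (h₁.prod : Subgroup G)) m hm =>
        h₂.commute k hk.1 m hm).1 haW
    obtain ⟨k, hk, m, hm, rfl⟩ := h₁.mem_prod.1 hcL
    have hm1 : m = 1 := by
      refine hG.eq_one_of_commutator_mem hM₁ (h₁.inf_eq_bot hG) h₂ hK₂ hM₂ hm
        (fun x hx => ?_) fun x hx => ?_
      -- Since `d` commutes with `x ∈ K₂`, the commutator of `m` with `x` equals that of `m * d`,
      -- and `m * d = k⁻¹ * (c * d)` lies in the normal subgroup `K₁`.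
      · have hk' : m * d ∈ K₁ := by
          have := K₁.mul_mem (K₁.inv_mem hk) ha
          simpa [mul_assoc] using this
        have e : m * x * m⁻¹ * x⁻¹ = (m * d) * (x * (m * d)⁻¹ * x⁻¹) := by
          have h3 := h₂.commute x hx d hd
          have h4 : d * x * d⁻¹ = x := by rw [← h3, mul_inv_cancel_right]
          calc m * x * m⁻¹ * x⁻¹ = m * (d * x * d⁻¹) * m⁻¹ * x⁻¹ := by rw [h4]
            _ = _ := by group
        rw [e]
        exact K₁.mul_mem hk' (hK₁.conj_mem x (hK₂.le x hx) _ (K₁.inv_mem hk'))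
      -- Here `c = k * m` commutes with `x ∈ M₂`, so the commutator of `m` with `x` can be rewritten
      -- in terms of `k` and `x` alone.
      · have h3 := h₂.commute _ hc x hx
        have h4 : k * m * x * (k * m)⁻¹ = x := by rw [h3, mul_inv_cancel_right]
        have e : m * x * m⁻¹ * x⁻¹ = k⁻¹ * (x * k * x⁻¹) := by
          calc m * x * m⁻¹ * x⁻¹ = k⁻¹ * (k * m * x * (k * m)⁻¹) * k * x⁻¹ := by group
            _ = k⁻¹ * x * k * x⁻¹ := by rw [h4]
            _ = _ := by group
        rw [e]
        exact K₁.mul_mem (K₁.inv_mem hk) (hK₁.conj_mem x (hM₂.le x hx) _ hk)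
    subst hm1
    rw [mul_one] at hc ⊢
    exact Subgroup.mul_mem _ ((le_sup_left : K₁ ⊓ K₂ ≤ _) ⟨hk, hc⟩)
      ((le_sup_right : C ≤ (K₁ ⊓ K₂) ⊔ C) (hM₂C hd))
  refine Subgroup.isOpen_mono (sup_le hsub ((inf_le_left.trans hM₁C).trans le_sup_right))
    (h₁.inf_openSubgroup ⟨_, hW⟩).isOpen

/-- Intersecting all four factors with a compact open `U` inside both products makes them normal in
the same group without changing their classes. -/
theorem IsLocallyCStable.isDecompositionClass_inf (hG : IsLocallyCStable G) {α β : LocalClass G}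
    (hα : IsDecompositionClass α) (hβ : IsDecompositionClass β) : IsDecompositionClass (α ⊓ β) := by
  obtain ⟨K₁, M₁, h₁, rfl⟩ := hG.isDecompositionClass_iff.1 hα
  obtain ⟨K₂, M₂, h₂, rfl⟩ := hG.isDecompositionClass_iff.1 hβ
  obtain ⟨U, hU, hUL⟩ := exists_openSubgroup_isCompact_le (h₁.prod ⊓ h₂.prod)
  have key : ∀ {K M : Subgroup G} (h : IsOpenFactorPair K M), U ≤ h.prod →
      IsCompactNormalIn (K ⊓ (U : Subgroup G)) U := fun h hle =>
    IsCompactNormalIn.inf_openSubgroup (fun v hv => h.isCompactNormalIn.conj_mem v (hle hv)) h.left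
  have hl₁ : U ≤ h₁.prod := fun x hx => (hUL hx).1
  have hl₂ : U ≤ h₂.prod := fun x hx => (hUL hx).2
  have hs₁ : U ≤ h₁.symm.prod := fun x hx => by
    change x ∈ M₁ ⊔ K₁
    rw [sup_comm]
    exact hl₁ hx
  have hs₂ : U ≤ h₂.symm.prod := fun x hx => by
    change x ∈ M₂ ⊔ K₂
    rw [sup_comm]
    exact hl₂ hx
  refine hG.isDecompositionClass_iff.2 ⟨_, _, hG.isOpenFactorPair_inf hU (h₁.inf_openSubgroup U)
    (h₂.inf_openSubgroup U) (key h₁ hl₁) (key h₁.symm hs₁) (key h₂ hl₂) (key h₂.symm hs₂), ?_⟩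
  rw [← LocalClass.mk_inf_mk, LocalClass.mk_inf_openSubgroup, LocalClass.mk_inf_openSubgroup]

theorem IsLocallyCStable.isCentraliserClass_of_perp_perp (hG : IsLocallyCStable G)
    {γ : LocalClass G} (hγ : γ ∈ structureLattice G) (h : γ.perp.perp ≤ γ) :
    IsCentraliserClass γ :=
  ⟨γ.perp, hG.perp_mem_structureLattice hγ, le_antisymm (hG.le_perp_perp hγ) h⟩

end Decomposition

/-! ### The Boolean algebras `LC(G)` and `LD(G)` -/

section BooleanAlgebras

/-- A meet-semilattice with an involutive pseudocomplementation is a Boolean algebra. -/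
abbrev booleanAlgebraOfInfCompl {C : Type u} [SemilatticeInf C] [OrderBot C] (c : C → C)
    (hcc : ∀ a, c (c a) = a) (h : ∀ a b, a ⊓ b = ⊥ ↔ a ≤ c b) : BooleanAlgebra C :=
  have hanti : ∀ {a b : C}, a ≤ b → c b ≤ c a := fun {a b} hab => by
    rw [← h, eq_bot_iff, ← (h (c b) b).2 le_rfl]
    exact inf_le_inf_left _ hab
  have hanti' : ∀ {a b : C}, c a ≤ b → c b ≤ a := fun {a b} hab => by
    have := hanti hab
    rwa [hcc] at this
  { (inferInstance : SemilatticeInf C), (inferInstance : OrderBot C) with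
    sup := fun a b => c (c a ⊓ c b)
    le_sup_left := fun a b => by
      have := hanti (inf_le_left : c a ⊓ c b ≤ c a)
      rwa [hcc] at this
    le_sup_right := fun a b => by
      have := hanti (inf_le_right : c a ⊓ c b ≤ c b)
      rwa [hcc] at this
    sup_le := fun a b d had hbd => hanti' (le_inf (hanti had) (hanti hbd))
    -- Let `p` be the meet of the left side with the complement of the right side. Then `p ≤ c x`,
    -- and `p ⊓ c y` is below both `c x ⊓ c y` and its complement, so `p ≤ y`. Likewise `p ≤ z`,
    -- while `p ≤ c (y ⊓ z)`, so `p = ⊥`.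
    le_sup_inf := fun x y z => by
      change c (c x ⊓ c y) ⊓ c (c x ⊓ c z) ≤ c (c x ⊓ c (y ⊓ z))
      rw [← h]
      set p := c (c x ⊓ c y) ⊓ c (c x ⊓ c z) ⊓ (c x ⊓ c (y ⊓ z)) with hp
      have hx : p ≤ c x := inf_le_right.trans inf_le_left
      have hy : p ≤ y := by
        rw [← hcc y, ← h, eq_bot_iff, ← (h _ _).2 (inf_le_left.trans inf_le_left :
          p ≤ c (c x ⊓ c y))]
        exact le_inf inf_le_left (le_inf (inf_le_left.trans hx) inf_le_right)
      have hz : p ≤ z := by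
        rw [← hcc z, ← h, eq_bot_iff, ← (h _ _).2 (inf_le_left.trans inf_le_right :
          p ≤ c (c x ⊓ c z))]
        exact le_inf inf_le_left (le_inf (inf_le_left.trans hx) inf_le_right)
      rw [eq_bot_iff, ← (h _ _).2 (inf_le_right.trans inf_le_right : p ≤ c (y ⊓ z))]
      exact le_inf le_rfl (le_inf hy hz)
    compl := c
    top := c ⊥
    inf_compl_le_bot := fun x => by
      change x ⊓ c x ≤ ⊥
      rw [inf_comm, (h (c x) x).2 le_rfl]
    top_le_sup_compl := fun x => by
      change c ⊥ ≤ c (c x ⊓ c (c x))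
      refine hanti ?_
      rw [inf_comm, (h (c (c x)) (c x)).2 le_rfl]
    le_top := fun a => by
      change a ≤ c ⊥
      rw [← h, inf_bot_eq] }

variable {G : Type u} [Group G] [TopologicalSpace G] [IsTopologicalGroup G]
  [LocallyCompactSpace G] [TotallyDisconnectedSpace G]

/-- A family of locally normal classes that contains the trivial class, is closed under infima, `⊥` and
conjugation, and on which `⊥` is involutive, is a Boolean algebra on which the group acts. -/
theorem IsLocallyCStable.exists_booleanAlgebra (hG : IsLocallyCStable G) {p : LocalClass G → Prop}
    {C : Type u} (e : C ≃ {γ // p γ})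
    (hp : ∀ γ, p γ → γ ∈ structureLattice G) (hbot : p ⊥)
    (hinf : ∀ α β, p α → p β → p (α ⊓ β)) (hperp : ∀ α, p α → p α.perp)
    (hpp : ∀ α, p α → α.perp.perp = α) (hconj : ∀ (g : G) α, p α → p (α.conj g)) :
    ∃ (_ : BooleanAlgebra C) (τ : G →* (C ≃o C)),
      (∀ α β : C, α ≤ β ↔ (e α).1 ≤ (e β).1) ∧ (∀ α : C, (e αᶜ).1 = (e α).1.perp) ∧
      ∀ (g : G) (α : C), (e (τ g α)).1 = (e α).1.conj g := by
  let mk : ∀ γ, p γ → C := fun γ hγ => e.symm ⟨γ, hγ⟩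
  have hmk : ∀ γ hγ, (e (mk γ hγ)).1 = γ := fun γ hγ => by
    change (e (e.symm _)).1 = γ
    rw [e.apply_symm_apply]
  have hext : ∀ {a b : C}, (e a).1 = (e b).1 → a = b := fun h => e.injective (Subtype.ext h)
  let iS : SemilatticeInf C :=
    { PartialOrder.lift (fun a : C => (e a).1) fun _ _ h => hext h with
      inf := fun a b => mk _ (hinf _ _ (e a).2 (e b).2)
      inf_le_left := fun a b => (hmk _ _).trans_le inf_le_left
      inf_le_right := fun a b => (hmk _ _).trans_le inf_le_right
      le_inf := fun a b c hab hac => (le_inf hab hac).trans_eq (hmk _ _).symm }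
  let iB : OrderBot C :=
    { bot := mk ⊥ hbot
      bot_le := fun a => (hmk _ _).trans_le bot_le }
  let B : BooleanAlgebra C :=
    booleanAlgebraOfInfCompl (fun a => mk _ (hperp _ (e a).2))
      (fun a => hext (by rw [hmk, hmk, hpp _ (e a).2]))
      (fun a b => by
        have h1 : a ≤ mk _ (hperp _ (e b).2) ↔ (e a).1 ≤ (e b).1.perp := by
          change (e a).1 ≤ (e (mk _ (hperp _ (e b).2))).1 ↔ _
          rw [hmk]
        have h2 : (e (a ⊓ b)).1 = (e a).1 ⊓ (e b).1 := hmk _ _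
        have h3 : (e (⊥ : C)).1 = ⊥ := hmk _ _
        rw [h1, ← hG.inf_eq_bot_iff (hp _ (e a).2) (hp _ (e b).2), ← h2, ← h3]
        exact ⟨fun h => by rw [h], hext⟩)
  let f : G → (C ≃o C) := fun g =>
    { toFun := fun α => mk _ (hconj g _ (e α).2)
      invFun := fun α => mk _ (hconj g⁻¹ _ (e α).2)
      left_inv := fun α => hext (by
        rw [hmk, hmk, ← LocalClass.conj_mul, inv_mul_cancel, LocalClass.conj_one])
      right_inv := fun α => hext (by
        rw [hmk, hmk, ← LocalClass.conj_mul, mul_inv_cancel, LocalClass.conj_one])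
      map_rel_iff' := fun {α β} => by
        change (e (mk _ (hconj g _ (e α).2))).1 ≤ (e (mk _ (hconj g _ (e β).2))).1 ↔
          (e α).1 ≤ (e β).1
        rw [hmk, hmk]
        refine ⟨fun h => ?_, LocalClass.conj_mono g⟩
        have := LocalClass.conj_mono g⁻¹ h
        rwa [← LocalClass.conj_mul, ← LocalClass.conj_mul, inv_mul_cancel, LocalClass.conj_one,
          LocalClass.conj_one] at this }
  have hf : ∀ g α, (e (f g α)).1 = (e α).1.conj g := fun g α => hmk _ _
  refine ⟨B, ⟨⟨f, ?_⟩, ?_⟩, fun α β => Iff.rfl, fun α => hmk _ _, fun g α => hmk _ _⟩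
  · refine RelIso.ext fun α => hext ?_
    rw [hf, LocalClass.conj_one]
    rfl
  · intro g h
    refine RelIso.ext fun α => hext ?_
    change (e (f (g * h) α)).1 = (e (f g (f h α))).1
    rw [hf, hf, hf, LocalClass.conj_mul]

/-- The centraliser classes are the locally normal classes fixed by `⊥⊥`. Closure under meets holds
because `⊥⊥` is monotone. -/
theorem IsLocallyCStable.exists_booleanAlgebra_centraliserLattice (hG : IsLocallyCStable G) :
    ∃ (_ : BooleanAlgebra (CentraliserLattice G))
      (τ : G →* (CentraliserLattice G ≃o CentraliserLattice G)),
      (∀ α β : CentraliserLattice G, α ≤ β ↔ α.cls ≤ β.cls) ∧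
      (∀ α : CentraliserLattice G, αᶜ.cls = α.cls.perp) ∧
      ∀ (g : G) (α : CentraliserLattice G), (τ g α).cls = α.cls.conj g := by
  have hp : ∀ γ : LocalClass G, IsCentraliserClass γ → γ ∈ structureLattice G := by
    rintro _ ⟨α, hα, rfl⟩
    exact hG.perp_mem_structureLattice hα
  have hpp : ∀ γ : LocalClass G, IsCentraliserClass γ → γ.perp.perp = γ := by
    rintro _ ⟨α, hα, rfl⟩
    exact hG.perp_perp_perp hα
  refine hG.exists_booleanAlgebra (p := IsCentraliserClass) (Equiv.refl _) hp ?_ (fun α β hα hβ => ?_)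
    (fun α hα => ⟨α, hp α hα, rfl⟩) hpp ?_
  · refine hG.isCentraliserClass_of_perp_perp bot_mem_structureLattice ?_
    have h0 := bot_mem_structureLattice (G := G)
    have h1 := hG.perp_mem_structureLattice h0
    have h2 := hG.perp_mem_structureLattice h1
    -- The double complement of the trivial class lies below its single complement, with which it
    -- also has trivial meet, so it is trivial.
    have h3 : (⊥ : LocalClass G).perp.perp ≤ (⊥ : LocalClass G).perp :=
      (hG.inf_eq_bot_iff h2 h0).1 (inf_bot_eq _)
    exact (le_inf le_rfl h3).trans_eq ((hG.inf_eq_bot_iff h2 h1).2 le_rfl)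
  · refine hG.isCentraliserClass_of_perp_perp
      (inf_mem_structureLattice (hp α hα) (hp β hβ)) (le_inf ?_ ?_)
    · conv_rhs => rw [← hpp α hα]
      exact LocalClass.perp_anti (LocalClass.perp_anti inf_le_left)
    · conv_rhs => rw [← hpp β hβ]
      exact LocalClass.perp_anti (LocalClass.perp_anti inf_le_right)
  · rintro g _ ⟨α, hα, rfl⟩
    exact ⟨α.conj g, conj_mem_structureLattice hα g, (LocalClass.perp_conj g α).symm⟩

/-- Since `⊥` exchanges the two factors of an open product, it preserves this family and is visibly
involutive. The trivial class comes from the trivial factorisation of a compact open subgroup. -/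
theorem IsLocallyCStable.exists_booleanAlgebra_decompositionLattice (hG : IsLocallyCStable G) :
    ∃ (_ : BooleanAlgebra (DecompositionLattice G))
      (τ : G →* (DecompositionLattice G ≃o DecompositionLattice G)),
      (∀ α β : DecompositionLattice G, α ≤ β ↔ α.cls ≤ β.cls) ∧
      (∀ α : DecompositionLattice G, αᶜ.cls = α.cls.perp) ∧
      ∀ (g : G) (α : DecompositionLattice G), (τ g α).cls = α.cls.conj g := by
  refine hG.exists_booleanAlgebra (p := IsDecompositionClass) (Equiv.refl _) ?_ ?_
    (fun α β hα hβ => hG.isDecompositionClass_inf hα hβ) ?_ ?_ ?_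
  · rintro γ ⟨K, -, hK, -, -, -, rfl⟩
    exact ⟨K, hK, rfl⟩
  · obtain ⟨U, hU, -⟩ := exists_openSubgroup_isCompact_le (⊤ : OpenSubgroup G)
    refine hG.isDecompositionClass_iff.2 ⟨⊥, U, ⟨?_, hU, ?_, ?_⟩, rfl⟩
    · rw [Subgroup.coe_bot]
      exact isCompact_singleton
    · intro k hk m _
      rw [Subgroup.mem_bot.1 hk, one_mul, mul_one]
    · rw [bot_sup_eq]
      exact U.isOpen
  · intro α hα
    obtain ⟨K, M, h, rfl⟩ := hG.isDecompositionClass_iff.1 hα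
    exact hG.isDecompositionClass_iff.2 ⟨M, K, h.symm, h.perp_mk hG⟩
  · intro α hα
    obtain ⟨K, M, h, rfl⟩ := hG.isDecompositionClass_iff.1 hα
    rw [h.perp_mk hG, h.symm.perp_mk hG]
  · intro g α hα
    obtain ⟨K, M, h, rfl⟩ := hG.isDecompositionClass_iff.1 hα
    exact hG.isDecompositionClass_iff.2 ⟨_, _, h.map_conj g, LocalClass.conj_mk g K⟩

end BooleanAlgebras

/-! ### Stone duality -/

section Stone

variable {A : Type v} [BooleanAlgebra A]

namespace StoneSpace

theorem eq_of_subset {p q : StoneSpace A} (h : p.carrier ⊆ q.carrier) : p = q := by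
  refine StoneSpace.ext (Set.Subset.antisymm h fun a ha => ?_)
  by_contra hp
  exact (q.compl_mem_iff a).1 (h ((p.compl_mem_iff a).2 hp)) ha

theorem bot_notMem (p : StoneSpace A) : ⊥ ∉ p.carrier := by
  rw [← compl_top, p.compl_mem_iff, not_not]
  exact p.top_mem

/-- The complement of a prime ideal is an ultrafilter. -/
def ofPrimeIdeal (J : Order.Ideal A) (hJ : J.IsPrime) : StoneSpace A where
  carrier := {a | a ∉ J}
  top_mem := hJ.toIsProper.top_notMem
  inf_mem a ha b hb h := (hJ.mem_or_mem h).elim ha hb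
  mem_of_le a ha b hab h := ha (J.lower hab h)
  compl_mem_iff a := by
    constructor
    · intro h h'
      exact (hJ.mem_or_mem (x := a) (y := aᶜ)
        (by rw [inf_compl_eq_bot]; exact J.bot_mem)).elim h' h
    · intro h h'
      have ha : a ∈ J := not_not.1 h
      refine hJ.toIsProper.top_notMem ?_
      rw [← sup_compl_eq_top (x := a)]
      exact Order.Ideal.sup_mem ha h'

/-- A proper ideal is avoided by some ultrafilter. -/
theorem exists_disjoint_ideal (I : Order.Ideal A) (hI : ⊤ ∉ I) :
    ∃ p : StoneSpace A, ∀ a ∈ p.carrier, a ∉ I := by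
  obtain ⟨J, hJ, hIJ, -⟩ := DistribLattice.prime_ideal_of_disjoint_filter_ideal
    (F := Order.PFilter.principal (⊤ : A)) (I := I) (by
      refine Set.disjoint_left.2 fun a ha haI => hI ?_
      have : a = ⊤ := top_le_iff.1 ha
      exact this ▸ haI)
  exact ⟨ofPrimeIdeal J hJ, fun a ha haI => ha (hIJ haI)⟩

theorem exists_mem_of_ne_bot {a : A} (ha : a ≠ ⊥) : ∃ p : StoneSpace A, a ∈ p.carrier := by
  obtain ⟨p, hp⟩ := exists_disjoint_ideal (Order.Ideal.principal aᶜ) (fun h => ha (by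
    have h' : ⊤ ≤ aᶜ := h
    rw [top_le_iff, compl_eq_top] at h'
    exact h'))
  refine ⟨p, ?_⟩
  by_contra h
  exact hp aᶜ ((p.compl_mem_iff a).2 h) (le_refl aᶜ)

theorem isTopologicalBasis : TopologicalSpace.IsTopologicalBasis
    {s | ∃ a : A, s = {p : StoneSpace A | a ∈ p.carrier}} where
  exists_subset_inter := by
    rintro _ ⟨a, rfl⟩ _ ⟨b, rfl⟩ p ⟨ha, hb⟩
    exact ⟨_, ⟨a ⊓ b, rfl⟩, p.inf_mem a ha b hb,
      fun q hq => ⟨q.mem_of_le _ hq _ inf_le_left, q.mem_of_le _ hq _ inf_le_right⟩⟩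
  sUnion_eq := Set.eq_univ_of_forall fun p => ⟨_, ⟨⊤, rfl⟩, p.top_mem⟩
  eq_generateFrom := rfl

theorem isOpen_mem (a : A) : IsOpen {p : StoneSpace A | a ∈ p.carrier} :=
  TopologicalSpace.isOpen_generateFrom_of_mem ⟨a, rfl⟩

theorem isClopen_mem (a : A) : IsClopen {p : StoneSpace A | a ∈ p.carrier} := by
  refine ⟨⟨?_⟩, isOpen_mem a⟩
  convert isOpen_mem aᶜ using 1
  ext p
  exact (p.compl_mem_iff a).symm

theorem subset_iff {a b : A} :
    {p : StoneSpace A | a ∈ p.carrier} ⊆ {p : StoneSpace A | b ∈ p.carrier} ↔ a ≤ b := by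
  refine ⟨fun h => ?_, fun h p hp => p.mem_of_le a hp b h⟩
  by_contra hab
  have h0 : a ⊓ bᶜ ≠ ⊥ := fun h0 => hab (by
    rw [← disjoint_iff, disjoint_compl_right_iff] at h0
    exact h0)
  obtain ⟨p, hp⟩ := exists_mem_of_ne_bot h0
  exact (p.compl_mem_iff b).1 (p.mem_of_le _ hp _ inf_le_right)
    (h (p.mem_of_le _ hp _ inf_le_left))

/-- The ideal of the elements of the algebra whose basic open set lies in `S`. -/
def idealOfSubset (S : Set (StoneSpace A)) : Order.Ideal A :=
  Order.IsIdeal.toIdeal (I := {a : A | {p : StoneSpace A | a ∈ p.carrier} ⊆ S})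
    { IsLowerSet := fun _ _ hba ha => (subset_iff.2 hba).trans ha
      Nonempty := ⟨⊥, fun p hp => (p.bot_notMem hp).elim⟩
      Directed := fun a ha b hb => ⟨a ⊔ b, fun p hp => by
        by_cases hpa : a ∈ p.carrier
        · exact ha hpa
        · by_cases hpb : b ∈ p.carrier
          · exact hb hpb
          · refine ((p.compl_mem_iff (a ⊔ b)).1 ?_ hp).elim
            rw [compl_sup]
            exact p.inf_mem _ ((p.compl_mem_iff a).2 hpa) _ ((p.compl_mem_iff b).2 hpb),
        le_sup_left, le_sup_right⟩ }

/-- If the ideals attached to `S` and `Sᶜ` had a proper join, some ultrafilter would avoid both. But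
it lies in `S` or `Sᶜ`, and a basic neighbourhood there gives it an element of one of the ideals. So
some `i` and `j` from the two ideals have join `⊤`, and `i` cuts out `S`. -/
theorem exists_eq_of_isClopen {S : Set (StoneSpace A)} (hS : IsClopen S) :
    ∃ a : A, {p : StoneSpace A | a ∈ p.carrier} = S := by
  have hT : ⊤ ∈ idealOfSubset S ⊔ idealOfSubset Sᶜ := by
    by_contra hT
    obtain ⟨p, hp⟩ := exists_disjoint_ideal _ hT
    by_cases hpS : p ∈ S
    · obtain ⟨_, ⟨a, rfl⟩, hpa, haS⟩ := isTopologicalBasis.exists_subset_of_mem_open hpS hS.isOpen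
      exact hp a hpa ((le_sup_left : idealOfSubset S ≤ _) haS)
    · obtain ⟨_, ⟨a, rfl⟩, hpa, haS⟩ := isTopologicalBasis.exists_subset_of_mem_open
        (show p ∈ Sᶜ from hpS) hS.compl.isOpen
      exact hp a hpa ((le_sup_right : idealOfSubset Sᶜ ≤ _) haS)
  obtain ⟨i, hi, j, hj, hij⟩ := Order.Ideal.mem_sup.1 hT
  refine ⟨i, Set.Subset.antisymm hi fun p hp => ?_⟩
  by_contra hpi
  have hpj : j ∈ p.carrier := by
    refine p.mem_of_le iᶜ ((p.compl_mem_iff i).2 hpi) j ?_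
    rw [compl_le_iff_compl_le, ← codisjoint_iff_compl_le_left]
    exact codisjoint_iff_le_sup.2 hij
  exact hj hpj hp

/-- Stone duality: a Boolean algebra is the algebra of clopen subsets of its Stone space. -/
noncomputable def clopensIso (A : Type v) [BooleanAlgebra A] :
    A ≃o TopologicalSpace.Clopens (StoneSpace A) :=
  RelIso.ofSurjective
    (⟨⟨fun a => ⟨{p | a ∈ p.carrier}, isClopen_mem a⟩, fun a b h => by
      have h' : {p : StoneSpace A | a ∈ p.carrier} = {p : StoneSpace A | b ∈ p.carrier} :=
        congrArg (fun s : TopologicalSpace.Clopens (StoneSpace A) => (s : Set (StoneSpace A))) h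
      exact le_antisymm (subset_iff.1 h'.subset) (subset_iff.1 h'.superset)⟩,
      fun {_ _} => subset_iff⟩ : A ↪o TopologicalSpace.Clopens (StoneSpace A))
    (fun s => by
      obtain ⟨a, ha⟩ := exists_eq_of_isClopen s.isClopen
      exact ⟨a, TopologicalSpace.Clopens.ext ha⟩)

theorem clopensIso_map (e : A ≃o A) (a : A) :
    clopenHom (StoneSpace A) (stoneHom A e) (clopensIso A a) = clopensIso A (e a) := by
  refine TopologicalSpace.Clopens.ext ?_
  ext p
  exact Iff.rfl

theorem stoneHom_injective : Function.Injective (stoneHom A) := by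
  intro e e' h
  refine RelIso.ext fun a => (clopensIso A).injective ?_
  rw [← clopensIso_map, ← clopensIso_map, h]

instance : T2Space (StoneSpace A) := by
  refine ⟨fun p q hpq => ?_⟩
  have : ¬ p.carrier ⊆ q.carrier := fun h => hpq (eq_of_subset h)
  obtain ⟨a, hap, haq⟩ := Set.not_subset.1 this
  refine ⟨_, _, isOpen_mem a, isOpen_mem aᶜ, hap, (q.compl_mem_iff a).2 haq, ?_⟩
  exact Set.disjoint_left.2 fun r hr hr' => (r.compl_mem_iff a).1 hr' hr

end StoneSpace

section Profinite

variable (X : Type v) [TopologicalSpace X]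

/-- The ultrafilter of the clopen sets that contain a given point. -/
def clopenUltrafilter (x : X) : StoneSpace (TopologicalSpace.Clopens X) where
  carrier := {s | x ∈ s}
  top_mem := trivial
  inf_mem _ hs _ ht := ⟨hs, ht⟩
  mem_of_le _ hs _ hst := hst hs
  compl_mem_iff _ := Iff.rfl

variable [CompactSpace X] [T2Space X] [TotallyDisconnectedSpace X]

theorem exists_clopens_mem_notMem {x y : X} (h : x ≠ y) :
    ∃ s : TopologicalSpace.Clopens X, x ∈ s ∧ y ∉ s := by
  obtain ⟨V, hV, hx, hVy⟩ := compact_exists_isClopen_in_isOpen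
    (isOpen_compl_singleton : IsOpen ({y}ᶜ : Set X)) h
  exact ⟨⟨V, hV⟩, hx, fun hy => hVy hy rfl⟩

theorem clopenHom_injective : Function.Injective (clopenHom X) := by
  intro h h' e
  ext x
  by_contra hne
  obtain ⟨s, hs, hs'⟩ := exists_clopens_mem_notMem X hne
  have e1 := congrArg (fun f => f.symm s) e
  have e2 : x ∈ (clopenHom X h).symm s := hs
  change (clopenHom X h).symm s = (clopenHom X h').symm s at e1
  rw [e1] at e2
  exact hs' e2

/-- Clopen sets separate points, and by compactness the members of an ultrafilter of clopen sets
have a common point. -/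
theorem clopenUltrafilter_bijective : Function.Bijective (clopenUltrafilter X) := by
  constructor
  · intro x y h
    by_contra hne
    obtain ⟨s, hs, hs'⟩ := exists_clopens_mem_notMem X hne
    have : s ∈ (clopenUltrafilter X x).carrier := hs
    rw [h] at this
    exact hs' this
  · intro p
    have hne : (⋂ s : p.carrier, ((s : TopologicalSpace.Clopens X) : Set X)).Nonempty := by
      have : Nonempty p.carrier := ⟨⟨⊤, p.top_mem⟩⟩
      refine IsCompact.nonempty_iInter_of_directed_nonempty_isCompact_isClosed _ ?_ ?_ ?_ ?_
      · intro s t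
        exact ⟨⟨s.1 ⊓ t.1, p.inf_mem _ s.2 _ t.2⟩, fun x hx => hx.1, fun x hx => hx.2⟩
      · intro s
        rw [Set.nonempty_iff_ne_empty]
        intro h
        have h' : s.1 = ⊥ := TopologicalSpace.Clopens.ext h
        exact p.bot_notMem (h' ▸ s.2)
      · exact fun s => s.1.isClopen.isClosed.isCompact
      · exact fun s => s.1.isClopen.isClosed
    obtain ⟨x, hx⟩ := hne
    refine ⟨x, (StoneSpace.eq_of_subset fun s hs => ?_).symm⟩
    exact Set.mem_iInter.1 hx ⟨s, hs⟩

/-- Stone duality: a profinite space is the Stone space of its algebra of clopen subsets. -/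
noncomputable def stoneHomeomorph : X ≃ₜ StoneSpace (TopologicalSpace.Clopens X) :=
  Continuous.homeoOfEquivCompactToT2
    (f := Equiv.ofBijective _ (clopenUltrafilter_bijective X)) (by
      refine continuous_generateFrom_iff.2 ?_
      rintro _ ⟨s, rfl⟩
      exact s.isClopen.isOpen)

theorem stoneHomeomorph_map (h : X ≃ₜ X) (x : X) :
    stoneHomeomorph X (h x) =
      stoneHom (TopologicalSpace.Clopens X) (clopenHom X h) (stoneHomeomorph X x) := by
  refine StoneSpace.ext ?_
  ext s
  exact Iff.rfl

end Profinite

end Stone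

/-! ### Transport of actions between algebras and Stone spaces -/

section Transport

variable {G : Type u} [Group G] [TopologicalSpace G] {A : Type v} [BooleanAlgebra A]
  {B : Type w} [BooleanAlgebra B]

theorem IsWeaklyBranch.of_orderIso {ρ : G →* (A ≃o A)} {ρ' : G →* (B ≃o B)} (h : IsWeaklyBranch ρ)
    (E : A ≃o B) (hE : ∀ g a, ρ' g (E a) = E (ρ g a)) : IsWeaklyBranch ρ' := by
  have hfix : ∀ g a, ρ' g (E a) = E a ↔ ρ g a = a := fun g a => by
    rw [hE, E.injective.eq_iff]
  constructor
  · intro b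
    obtain ⟨a, rfl⟩ := E.surjective b
    simp only [hfix]
    exact h.1 a
  · intro b hb
    obtain ⟨a, rfl⟩ := E.surjective b
    obtain ⟨g, hg, hgk⟩ := h.2 a (fun ha => hb (by rw [ha, map_bot]))
    refine ⟨g, fun c hc => ?_, fun hk => hgk ?_⟩
    · obtain ⟨d, rfl⟩ := E.surjective c
      rw [hfix]
      refine hg d ?_
      rwa [← map_compl' E a, E.le_iff_le] at hc
    · refine RelIso.ext fun a => (hfix g a).1 ?_
      rw [MonoidHom.mem_ker] at hk
      rw [hk]
      rfl

theorem IsWeaklyBranch.stone {ρ : G →* (A ≃o A)} (h : IsWeaklyBranch ρ) :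
    IsWeaklyBranch ((clopenHom (StoneSpace A)).comp ((stoneHom A).comp ρ)) :=
  h.of_orderIso (StoneSpace.clopensIso A) fun g a => StoneSpace.clopensIso_map (ρ g) a

/-- The map pulls ultrafilters back along the embedding of algebras; it is onto because ultrafilters
of a subalgebra extend. -/
theorem OccursOnSubalgebra.isQuotientOfStoneSpace {ρ : G →* (A ≃o A)} {τ : G →* (B ≃o B)}
    (h : OccursOnSubalgebra ρ τ) : IsQuotientOfStoneSpace τ ((stoneHom A).comp ρ) := by
  obtain ⟨C, -, e, he⟩ := h
  let f : StoneSpace B → StoneSpace A := fun p =>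
    { carrier := {a | (e a : B) ∈ p.carrier}
      top_mem := by
        change ((e ⊤ : C) : B) ∈ p.carrier
        rw [map_top]
        exact p.top_mem
      inf_mem := fun a ha b hb => by
        change ((e (a ⊓ b) : C) : B) ∈ p.carrier
        rw [map_inf]
        exact p.inf_mem _ ha _ hb
      mem_of_le := fun a ha b hab => p.mem_of_le _ ha _ (e.monotone hab)
      compl_mem_iff := fun a => by
        change ((e aᶜ : C) : B) ∈ p.carrier ↔ ((e a : C) : B) ∉ p.carrier
        rw [map_compl' e a]
        exact p.compl_mem_iff _ }
  refine ⟨f, ?_, ?_, ?_⟩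
  · refine continuous_generateFrom_iff.2 ?_
    rintro _ ⟨a, rfl⟩
    exact StoneSpace.isOpen_mem (e a : B)
  · intro q
    -- The ideal generated by the images of the elements outside `q` is proper. An ultrafilter
    -- avoiding it restricts into `q`, and inclusion of ultrafilters is equality.
    let I : Order.Ideal B := Order.IsIdeal.toIdeal (I := {b : B | ∃ a ∉ q.carrier, b ≤ e a})
      { IsLowerSet := fun b c hcb ⟨a, ha, hb⟩ => ⟨a, ha, hcb.trans hb⟩
        Nonempty := ⟨⊥, ⊥, q.bot_notMem, bot_le⟩
        Directed := by
          rintro b ⟨a, ha, hb⟩ b' ⟨a', ha', hb'⟩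
          refine ⟨e (a ⊔ a'), ⟨a ⊔ a', ?_, le_rfl⟩,
            hb.trans (e.monotone le_sup_left), hb'.trans (e.monotone le_sup_right)⟩
          rw [← q.compl_mem_iff, compl_sup]
          exact q.inf_mem _ ((q.compl_mem_iff a).2 ha) _ ((q.compl_mem_iff a').2 ha') }
    obtain ⟨p, hp⟩ := StoneSpace.exists_disjoint_ideal I (by
      rintro ⟨a, ha, hT⟩
      have h1 : e ⊤ ≤ e a := by
        rw [map_top]
        exact hT
      exact ha (q.mem_of_le _ q.top_mem _ (e.le_iff_le.1 h1)))
    refine ⟨p, StoneSpace.eq_of_subset fun a ha => ?_⟩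
    by_contra haq
    exact hp _ ha ⟨a, haq, le_rfl⟩
  · intro g p
    refine StoneSpace.ext ?_
    ext a
    obtain ⟨b, rfl⟩ := (ρ g).surjective a
    change (τ g).symm (e (ρ g b) : B) ∈ p.carrier ↔ (e ((ρ g).symm (ρ g b)) : B) ∈ p.carrier
    rw [he, OrderIso.symm_apply_apply, OrderIso.symm_apply_apply]

theorem IsQuotientOfStoneSpace.of_clopens {X : Type v} [TopologicalSpace X] [CompactSpace X]
    [T2Space X] [TotallyDisconnectedSpace X] {σ : G →* (X ≃ₜ X)} {τ : G →* (B ≃o B)}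
    (h : IsQuotientOfStoneSpace τ
      ((stoneHom (TopologicalSpace.Clopens X)).comp ((clopenHom X).comp σ))) :
    IsQuotientOfStoneSpace τ σ := by
  obtain ⟨f, hf, hs, he⟩ := h
  refine ⟨(stoneHomeomorph X).symm ∘ f, (stoneHomeomorph X).symm.continuous.comp hf,
    (stoneHomeomorph X).symm.surjective.comp hs, fun g p => ?_⟩
  apply (stoneHomeomorph X).injective
  rw [stoneHomeomorph_map, Function.comp_apply, Function.comp_apply,
    Homeomorph.apply_symm_apply, Homeomorph.apply_symm_apply]
  exact he g p

end Transport

/-! ### Rigid stabilisers and branch actions -/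

section Rist

variable {G : Type u} [Group G] [TopologicalSpace G] {A : Type v} [BooleanAlgebra A]
  {ρ : G →* (A ≃o A)}

theorem map_mul_apply (ρ : G →* (A ≃o A)) (g h : G) (a : A) : ρ (g * h) a = ρ g (ρ h a) := by
  rw [map_mul, RelIso.mul_apply]

theorem map_inv_apply_map (ρ : G →* (A ≃o A)) (g : G) (a : A) : ρ g⁻¹ (ρ g a) = a := by
  rw [← map_mul_apply, inv_mul_cancel, map_one, RelIso.one_apply]

theorem map_apply_map_inv (ρ : G →* (A ≃o A)) (g : G) (a : A) : ρ g (ρ g⁻¹ a) = a := by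
  rw [← map_mul_apply, mul_inv_cancel, map_one, RelIso.one_apply]

theorem rist_mono {a b : A} (h : a ≤ b) : rist ρ a ≤ rist ρ b :=
  fun _ hg c hc => hg c (hc.trans (compl_le_compl h))

/-- An element below `(a ⊓ b)ᶜ` splits into a part below `aᶜ` and a part below `bᶜ`. -/
theorem rist_inf (a b : A) : rist ρ (a ⊓ b) = rist ρ a ⊓ rist ρ b := by
  refine le_antisymm (le_inf (rist_mono inf_le_left) (rist_mono inf_le_right)) ?_
  rintro g ⟨ha, hb⟩ c hc
  have e : c = c ⊓ aᶜ ⊔ c ⊓ bᶜ := by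
    rw [← inf_sup_left, ← compl_inf, inf_eq_left.2 hc]
  rw [e, map_sup, ha _ inf_le_right, hb _ inf_le_right]

theorem rist_bot (hρ : Function.Injective ρ) : rist ρ ⊥ = ⊥ := by
  rw [eq_bot_iff]
  intro g hg
  refine Subgroup.mem_bot.2 (hρ ?_)
  rw [map_one]
  refine RelIso.ext fun b => hg b ?_
  rw [compl_bot]
  exact le_top

theorem rist_inf_rist_compl (hρ : Function.Injective ρ) (a : A) : rist ρ a ⊓ rist ρ aᶜ = ⊥ := by
  rw [← rist_inf, inf_compl_eq_bot, rist_bot hρ]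

theorem conj_mem_rist {a : A} {g : G} (h : G) (hg : g ∈ rist ρ a) :
    h * g * h⁻¹ ∈ rist ρ (ρ h a) := by
  intro b hb
  have hb' : ρ h⁻¹ b ≤ aᶜ := by
    rw [← map_compl' (ρ h) a] at hb
    have := (ρ h⁻¹).monotone hb
    rwa [map_inv_apply_map] at this
  rw [map_mul_apply, map_mul_apply, hg _ hb', map_apply_map_inv]

/-- Both groups fix `a` and `aᶜ`, so each normalises the other, and by faithfulness they meet
trivially. -/
theorem commute_of_mem_rist (hρ : Function.Injective ρ) (a : A) :
    ∀ g ∈ rist ρ a, ∀ h ∈ rist ρ aᶜ, g * h = h * g := by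
  refine commute_of_conj_mem_of_inf_eq_bot (fun h hh g hg => ?_) (fun g hg h hh => ?_)
    (rist_inf_rist_compl hρ a)
  · have e : ρ h a = a := hh a (by rw [compl_compl])
    have := conj_mem_rist h hg
    rwa [e] at this
  · have e : ρ g aᶜ = aᶜ := hg aᶜ le_rfl
    have := conj_mem_rist g hh
    rwa [e] at this

/-- The stabiliser of a point under a smooth action. -/
def IsSmooth.stabilizer (hs : IsSmooth ρ) (a : A) : OpenSubgroup G where
  carrier := {g | ρ g a = a}
  one_mem' := by
    change ρ 1 a = a
    rw [map_one, RelIso.one_apply]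
  mul_mem' {g h} hg hh := by
    change ρ (g * h) a = a
    rw [map_mul_apply, show ρ h a = a from hh, show ρ g a = a from hg]
  inv_mem' {g} hg := by
    change ρ g⁻¹ a = a
    conv_lhs => rw [← show ρ g a = a from hg]
    exact map_inv_apply_map ρ g a
  isOpen' := hs a

theorem IsSmooth.conj_mem_rist (hs : IsSmooth ρ) (a : A) :
    ∀ h ∈ hs.stabilizer a, ∀ g ∈ rist ρ a, h * g * h⁻¹ ∈ rist ρ a := by
  intro h hh g hg
  have := TDLC.conj_mem_rist h hg
  rwa [show ρ h a = a from hh] at this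

variable [IsTopologicalGroup G]

theorem IsSmooth.isClosed_rist (hs : IsSmooth ρ) (a : A) : IsClosed (rist ρ a : Set G) := by
  have e : (rist ρ a : Set G) = ⋂ b : {b // b ≤ aᶜ}, (hs.stabilizer b.1 : Set G) := by
    ext g
    rw [Set.mem_iInter]
    exact ⟨fun h b => h b.1 b.2, fun h b hb => h ⟨b, hb⟩⟩
  rw [e]
  exact isClosed_iInter fun b => (hs.stabilizer b.1).isClosed

/-- The rigid stabiliser is normalised by the open stabiliser of `a`, so if discrete it is trivial.
The weakly branch condition excludes this for `a ≠ ⊥`. -/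
theorem IsWeaklyBranch.eq_bot_of_discrete (hQ : TrivialQuasiCentre G) (hρ : IsWeaklyBranch ρ)
    {a : A} {V : OpenSubgroup G} (h : ∀ g ∈ rist ρ a, g ∈ V → g = 1) : a = ⊥ := by
  by_contra ha
  obtain ⟨g, hg, hgk⟩ := hρ.2 a ha
  rw [hQ.eq_bot_of_discrete (V := (V : Set G)) V.mem_nhds_one h (hρ.1.conj_mem_rist a),
    Subgroup.mem_bot] at hg
  exact hgk (hg ▸ one_mem _)

/-- A non-trivially moved element contains a nonzero element that is moved off itself. -/
theorem exists_inf_map_eq_bot {e : A ≃o A} {b : A} (h : e b ≠ b) :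
    ∃ c ≤ b, c ≠ ⊥ ∧ c ⊓ e c = ⊥ := by
  by_cases hle : b ≤ e b
  · have hne : ¬ e b ≤ b := fun h' => h (le_antisymm h' hle)
    refine ⟨e.symm (e b ⊓ bᶜ), ?_, fun h0 => hne ?_, ?_⟩
    · rw [e.symm_apply_le]
      exact inf_le_left
    · rw [map_eq_bot_iff] at h0
      rwa [← disjoint_iff, disjoint_compl_right_iff] at h0
    · rw [e.apply_symm_apply, ← disjoint_iff]
      refine Disjoint.mono (?_ : _ ≤ b) inf_le_right disjoint_compl_right
      rw [e.symm_apply_le]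
      exact inf_le_left
  · refine ⟨b ⊓ (e b)ᶜ, inf_le_left, fun h0 => hle ?_, ?_⟩
    · rwa [← disjoint_iff, disjoint_compl_right_iff] at h0
    · rw [← disjoint_iff]
      exact Disjoint.mono inf_le_right (e.monotone inf_le_left) disjoint_compl_left

/-- Suppose `g` centralises `rist ρ a ⊓ V` and moves some `b ≤ a`. Take a nonzero `c ≤ b` disjoint
from its image under `g`. Elements of `rist ρ c ⊓ V` equal their conjugates by `g`, so they also lie
in the rigid stabiliser of that image and are trivial. Then `rist ρ c` is discrete, which
contradicts `c ≠ ⊥`. -/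
theorem IsWeaklyBranch.quasiCentraliser_rist (hQ : TrivialQuasiCentre G) (hρ : IsWeaklyBranch ρ)
    (hi : Function.Injective ρ) (a : A) : quasiCentraliser ⊤ (rist ρ a) = rist ρ aᶜ := by
  refine le_antisymm ?_ fun h hh => ⟨trivial, ⊤, Subgroup.mem_centralizer_iff.2 fun g hg =>
    commute_of_mem_rist hi a g hg.1 h hh⟩
  rintro g ⟨-, V, hV⟩ b hb
  rw [compl_compl] at hb
  by_contra hne
  obtain ⟨c, hcb, hc0, hc⟩ := exists_inf_map_eq_bot hne
  refine hc0 (hρ.eq_bot_of_discrete hQ (V := V) fun x hx hxV => ?_)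
  have h1 := Subgroup.mem_centralizer_iff.1 hV x ⟨rist_mono (hcb.trans hb) hx, hxV⟩
  have h2 : x ∈ rist ρ c ⊓ rist ρ (ρ g c) := by
    refine ⟨hx, ?_⟩
    have := conj_mem_rist g hx
    rwa [← h1, mul_inv_cancel_right] at this
  rwa [← rist_inf, hc, rist_bot hi, Subgroup.mem_bot] at h2

/-- A local inclusion puts an open part of `rist ρ (a ⊓ bᶜ)` into both `rist ρ b` and `rist ρ bᶜ`,
so `a ⊓ bᶜ = ⊥`. -/
theorem IsWeaklyBranch.mk_rist_le_mk_rist_iff (hQ : TrivialQuasiCentre G) (hρ : IsWeaklyBranch ρ)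
    (hi : Function.Injective ρ) {a b : A} :
    LocalClass.mk (rist ρ a) ≤ LocalClass.mk (rist ρ b) ↔ a ≤ b := by
  refine ⟨?_, fun h => LocalClass.mk_mono (rist_mono h)⟩
  rintro ⟨V, hV⟩
  rw [← disjoint_compl_right_iff, disjoint_iff]
  refine hρ.eq_bot_of_discrete hQ (V := V) fun x hx hxV => ?_
  rw [rist_inf] at hx
  have : x ∈ rist ρ b ⊓ rist ρ bᶜ := ⟨hV ⟨hx.1, hxV⟩, hx.2⟩
  rwa [rist_inf_rist_compl hi, Subgroup.mem_bot] at this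

theorem rist_map_conj (ρ : G →* (A ≃o A)) (g : G) (a : A) :
    (rist ρ a).map (MulAut.conj g).toMonoidHom = rist ρ (ρ g a) := by
  ext x
  rw [mem_map_conj_iff]
  constructor
  · intro h
    have := conj_mem_rist g h
    convert this using 1
    group
  · intro h
    have := conj_mem_rist g⁻¹ h
    rw [map_inv_apply_map] at this
    convert this using 1
    group

/-- A faithful weakly branch action occurs on a subalgebra of any Boolean algebra of local classes
that contains the classes of its rigid stabilisers. -/
theorem IsWeaklyBranch.occursOnSubalgebra (hQ : TrivialQuasiCentre G) (hρ : IsWeaklyBranch ρ)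
    (hi : Function.Injective ρ) {M : Type w} [BooleanAlgebra M] {τ : G →* (M ≃o M)}
    {cls : M → LocalClass G} (hle : ∀ α β, α ≤ β ↔ cls α ≤ cls β)
    (hcompl : ∀ α, cls αᶜ = (cls α).perp) (hconj : ∀ g α, cls (τ g α) = (cls α).conj g)
    (hr : ∀ a, ∃ α, cls α = LocalClass.mk (rist ρ a)) : OccursOnSubalgebra ρ τ := by
  have hinj : ∀ {α β : M}, cls α = cls β → α = β := fun h =>
    le_antisymm ((hle _ _).2 h.le) ((hle _ _).2 h.ge)
  choose φ hφ using hr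
  have hφle : ∀ {a b}, φ a ≤ φ b ↔ a ≤ b := fun {a b} => by
    rw [hle, hφ, hφ, hρ.mk_rist_le_mk_rist_iff hQ hi]
  have hφc : ∀ a, φ aᶜ = (φ a)ᶜ := fun a => hinj (by
    rw [hcompl, hφ, hφ, LocalClass.perp_mk, hρ.quasiCentraliser_rist hQ hi])
  have hφbot : φ ⊥ = ⊥ := le_bot_iff.1 ((hle _ _).2 (by
    rw [hφ, rist_bot hi]
    exact bot_le))
  have hφinf : ∀ a b, φ (a ⊓ b) = φ a ⊓ φ b := fun a b =>
    le_antisymm (le_inf (hφle.2 inf_le_left) (hφle.2 inf_le_right)) ((hle _ _).2 (by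
      rw [hφ, rist_inf, LocalClass.le_mk_inf, ← hφ, ← hφ, ← hle, ← hle]
      exact ⟨inf_le_left, inf_le_right⟩))
  -- Joins of classes have no direct description by rigid stabilisers, so they are reached through
  -- De Morgan.
  have hφsup : ∀ a b, φ (a ⊔ b) = φ a ⊔ φ b := fun a b => by
    rw [← compl_compl (a ⊔ b), hφc, compl_sup, hφinf, hφc, hφc, compl_inf, compl_compl,
      compl_compl]
  have hφg : ∀ g a, φ (ρ g a) = τ g (φ a) := fun g a => hinj (by
    rw [hconj, hφ, hφ, LocalClass.conj_mk, rist_map_conj])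
  let B : BooleanSubalgebra M :=
    { carrier := Set.range φ
      supClosed' := by
        rintro _ ⟨a, rfl⟩ _ ⟨b, rfl⟩
        exact ⟨_, hφsup a b⟩
      infClosed' := by
        rintro _ ⟨a, rfl⟩ _ ⟨b, rfl⟩
        exact ⟨_, hφinf a b⟩
      compl_mem' := by
        rintro _ ⟨a, rfl⟩
        exact ⟨_, hφc a⟩
      bot_mem' := ⟨⊥, hφbot⟩ }
  let f : A ↪o B := OrderEmbedding.ofMapLEIff (fun a => ⟨φ a, a, rfl⟩) fun a b => hφle
  refine ⟨B, ?_, RelIso.ofSurjective f ?_, fun g a => hφg g a⟩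
  · rintro g _ ⟨a, rfl⟩
    exact ⟨_, hφg g a⟩
  · rintro ⟨_, a, rfl⟩
    exact ⟨a, rfl⟩

variable [LocallyCompactSpace G] [TotallyDisconnectedSpace G]

theorem IsSmooth.mk_rist_mem_structureLattice (hs : IsSmooth ρ) (a : A) :
    LocalClass.mk (rist ρ a) ∈ structureLattice G := by
  obtain ⟨U, hU, hUN⟩ := exists_openSubgroup_isCompact_le (hs.stabilizer a)
  refine ⟨rist ρ a ⊓ (U : Subgroup G), ⟨hU.inter_left (hs.isClosed_rist a), ?_⟩,
    LocalClass.mk_inf_openSubgroup _ _⟩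
  refine Subgroup.isOpen_mono (H₁ := (U : Subgroup G))
    (Subgroup.le_normalizer_iff.2 fun u hu x hx => ?_) U.isOpen
  exact ⟨hs.conj_mem_rist a u (hUN hu) x hx.1, U.mul_mem (U.mul_mem hu hx.2) (U.inv_mem hu)⟩

theorem IsWeaklyBranch.isCentraliserClass_mk_rist (hQ : TrivialQuasiCentre G)
    (hρ : IsWeaklyBranch ρ) (hi : Function.Injective ρ) (a : A) :
    IsCentraliserClass (LocalClass.mk (rist ρ a)) := by
  refine ⟨_, hρ.1.mk_rist_mem_structureLattice aᶜ, ?_⟩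
  rw [LocalClass.perp_mk, hρ.quasiCentraliser_rist hQ hi, compl_compl]

/-- Rigid stabilisers are closed, hence σ-compact, so the open mapping theorem applies to their
product, with any compact open `U`. -/
theorem IsLocallyBranch.hasLocallyOpenRistProducts [SigmaCompactSpace G] (hρ : IsLocallyBranch ρ)
    (hi : Function.Injective ρ) : HasLocallyOpenRistProducts ρ := by
  intro a
  obtain ⟨U, hU, -⟩ := exists_openSubgroup_isCompact_le (⊤ : OpenSubgroup G)
  refine ⟨U, U.isOpen, hU, ?_⟩
  have hσ : ∀ b, SigmaCompactSpace (rist ρ b) := fun b =>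
    (hρ.1.1.isClosed_rist b).isClosedEmbedding_subtypeVal.sigmaCompactSpace
  have := hσ a
  have := hσ aᶜ
  refine isOpen_mul_inter_of_isOpen_sup (commute_of_mem_rist hi a) ?_ U.isOpen
  rw [coe_sup_of_commute (commute_of_mem_rist hi a)]
  exact hρ.2 a

theorem IsLocallyCStable.isDecompositionClass_mk_rist (hG : IsLocallyCStable G)
    (hs : IsSmooth ρ) (hi : Function.Injective ρ) (h : HasLocallyOpenRistProducts ρ) (a : A) :
    IsDecompositionClass (LocalClass.mk (rist ρ a)) := by
  obtain ⟨U, hUo, hUc, hUr⟩ := h a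
  have hc : ∀ g ∈ rist ρ a ⊓ U, ∀ h ∈ rist ρ aᶜ ⊓ U, g * h = h * g :=
    fun g hg h hh => commute_of_mem_rist hi a g hg.1 h hh.1
  refine hG.isDecompositionClass_iff.2 ⟨rist ρ a ⊓ U, rist ρ aᶜ ⊓ U,
    ⟨hUc.inter_left (hs.isClosed_rist a), hUc.inter_left (hs.isClosed_rist aᶜ), hc, ?_⟩, ?_⟩
  · rw [coe_sup_of_commute hc]
    exact hUr
  · exact (LocalClass.mk_inf_openSubgroup _ ⟨U, hUo⟩).symm

/-- A faithful conjugation action on a Boolean algebra of locally normal classes is weakly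
branch. -/
theorem IsLocallyCStable.isWeaklyBranch_of_injective (hG : IsLocallyCStable G)
    {M : Type w} [BooleanAlgebra M] {τ : G →* (M ≃o M)} {cls : M → LocalClass G}
    (hmem : ∀ α, cls α ∈ structureLattice G) (hle : ∀ α β, α ≤ β ↔ cls α ≤ cls β)
    (hcompl : ∀ α, cls αᶜ = (cls α).perp) (hconj : ∀ g α, cls (τ g α) = (cls α).conj g)
    (hτ : Function.Injective τ) : IsWeaklyBranch τ := by
  have hinj : ∀ {α β : M}, cls α = cls β → α = β := fun h =>
    le_antisymm ((hle _ _).2 h.le) ((hle _ _).2 h.ge)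
  constructor
  · intro α
    obtain ⟨H, hH, hHα⟩ := hmem α
    obtain ⟨N, hN⟩ := hH.exists_openSubgroup
    let S : Subgroup G :=
      { carrier := {g | τ g α = α}
        one_mem' := by
          change τ 1 α = α
          rw [map_one, RelIso.one_apply]
        mul_mem' := fun {g h} hg hh => by
          change τ (g * h) α = α
          rw [map_mul_apply, show τ h α = α from hh, show τ g α = α from hg]
        inv_mem' := fun {g} hg => by
          change τ g⁻¹ α = α
          conv_lhs => rw [← show τ g α = α from hg]
          exact map_inv_apply_map τ g α }
    refine Subgroup.isOpen_mono (H₁ := (N : Subgroup G)) (H₂ := S) (fun g hg => hinj ?_) N.isOpen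
    rw [hconj, ← hHα, LocalClass.conj_mk]
    congr 1
    ext x
    rw [mem_map_conj_iff]
    constructor
    · intro h
      have := hN g hg _ h
      convert this using 1
      group
    · intro h
      have := hN g⁻¹ (N.inv_mem hg) _ h
      rwa [inv_inv] at this
  · intro α hα
    obtain ⟨H, hH, hHα⟩ := hmem α
    obtain ⟨U, hU, hHU, -⟩ := exists_isCompactNormalIn_pair hH hH
    rw [← LocalClass.mk_inf_openSubgroup H U] at hHα
    set L := H ⊓ (U : Subgroup G)
    have hL : L ≠ ⊥ := fun hL => hα (le_bot_iff.1 ((hle _ _).2 (by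
      rw [← hHα, hL]
      exact bot_le)))
    -- Any nontrivial `x ∈ L` will do. A class below the complement of `α` has a representative in
    -- the centraliser of `L`, which `x` fixes elementwise under conjugation. Faithfulness keeps `x`
    -- out of the kernel.
    obtain ⟨x, hx, hx1⟩ := (Subgroup.ne_bot_iff_exists_ne_one).1 hL |>.elim
      fun x hx => (⟨x.1, x.2, fun h => hx (Subtype.ext h)⟩ : ∃ x ∈ L, x ≠ 1)
    refine ⟨x, fun β hβ => hinj ?_, fun hk => hx1 (hτ ?_)⟩
    · rw [hconj]
      rw [hle, hcompl, ← hHα, hG.perp_mk_eq hU hHU] at hβ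
      generalize cls β = γ at hβ
      induction γ using Quotient.inductionOn with | _ K
      obtain ⟨V, hV⟩ := hβ
      change (LocalClass.mk K).conj x = LocalClass.mk K
      rw [← LocalClass.mk_inf_openSubgroup K V, LocalClass.conj_mk]
      have hcomm : ∀ y ∈ K ⊓ (V : Subgroup G), x * y = y * x := fun y hy =>
        Subgroup.mem_centralizer_iff.1 (hV hy).1 x hx
      congr 1
      ext y
      constructor
      · rintro ⟨z, hz, rfl⟩
        change x * z * x⁻¹ ∈ _
        rwa [hcomm z hz, mul_inv_cancel_right]
      · intro hy
        rw [mem_map_conj_iff, mul_assoc, ← hcomm y hy, inv_mul_cancel_left]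
        exact hy
    · rw [MonoidHom.mem_ker.1 hk, map_one]

end Rist

end TDLC

/-! ### Assembly of the theorem -/

theorem mainTheorem3 {G : Type*} [Group G] [TopologicalSpace G] [IsTopologicalGroup G]
    [LocallyCompactSpace G] [TotallyDisconnectedSpace G] (hG : IsLocallyCStable G) :
    -- `LC(G)` and `LD(G)` are Boolean algebras for the order on local classes, with complement
    -- `⊥`, and `G` acts on both by conjugation
    ∃ (_ : BooleanAlgebra (CentraliserLattice G)) (_ : BooleanAlgebra (DecompositionLattice G))
      (ρC : G →* (CentraliserLattice G ≃o CentraliserLattice G))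
      (ρD : G →* (DecompositionLattice G ≃o DecompositionLattice G)),
      (∀ α β : CentraliserLattice G, α ≤ β ↔ α.cls ≤ β.cls) ∧
      (∀ α : CentraliserLattice G, αᶜ.cls = α.cls.perp) ∧
      (∀ (g : G) (α : CentraliserLattice G), (ρC g α).cls = α.cls.conj g) ∧
      (∀ α β : DecompositionLattice G, α ≤ β ↔ α.cls ≤ β.cls) ∧
      (∀ α : DecompositionLattice G, αᶜ.cls = α.cls.perp) ∧
      (∀ (g : G) (α : DecompositionLattice G), (ρD g α).cls = α.cls.conj g) ∧
      -- if `G` acts faithfully on `LC(G)`, the action on its Stone space is faithful weakly branch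
      (Function.Injective ρC →
        Function.Injective ((stoneHom (CentraliserLattice G)).comp ρC) ∧
        IsWeaklyBranch ((clopenHom (StoneSpace (CentraliserLattice G))).comp
          ((stoneHom (CentraliserLattice G)).comp ρC))) ∧
      -- faithful weakly branch actions on Boolean algebras
      (∀ (A : Type*) [BooleanAlgebra A] (ρ : G →* (A ≃o A)),
        Function.Injective ρ → IsWeaklyBranch ρ →
        OccursOnSubalgebra ρ ρC ∧ IsQuotientOfStoneSpace ρC ((stoneHom A).comp ρ)) ∧
      -- faithful weakly branch actions on profinite spaces
      (∀ (X : Type*) [TopologicalSpace X] [CompactSpace X] [T2Space X] [TotallyDisconnectedSpace X]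
        (σ : G →* (X ≃ₜ X)),
        Function.Injective σ → IsWeaklyBranch ((clopenHom X).comp σ) →
        OccursOnSubalgebra ((clopenHom X).comp σ) ρC ∧
        IsQuotientOfStoneSpace ρC σ) ∧
      -- faithful locally branch actions on Boolean algebras
      (∀ (A : Type*) [BooleanAlgebra A] (ρ : G →* (A ≃o A)),
        Function.Injective ρ → IsLocallyBranch ρ →
        (SigmaCompactSpace G ∨ HasLocallyOpenRistProducts ρ) → OccursOnSubalgebra ρ ρD) ∧
      -- faithful locally branch actions on profinite spaces
      (∀ (X : Type*) [TopologicalSpace X] [CompactSpace X] [T2Space X] [TotallyDisconnectedSpace X]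
        (σ : G →* (X ≃ₜ X)),
        Function.Injective σ → IsLocallyBranch ((clopenHom X).comp σ) →
        (SigmaCompactSpace G ∨ HasLocallyOpenRistProducts ((clopenHom X).comp σ)) →
        OccursOnSubalgebra ((clopenHom X).comp σ) ρD) := by
  obtain ⟨BC, ρC, hCle, hCc, hCg⟩ := hG.exists_booleanAlgebra_centraliserLattice
  obtain ⟨BD, ρD, hDle, hDc, hDg⟩ := hG.exists_booleanAlgebra_decompositionLattice
  have hC : ∀ (A : Type _) [BooleanAlgebra A] (ρ : G →* (A ≃o A)),
      Function.Injective ρ → IsWeaklyBranch ρ → OccursOnSubalgebra ρ ρC := by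
    intro A _ ρ hi hρ
    exact hρ.occursOnSubalgebra hG.1 hi hCle hCc hCg fun a =>
      ⟨⟨_, hρ.isCentraliserClass_mk_rist hG.1 hi a⟩, rfl⟩
  have hC' : ∀ (X : Type _) [TopologicalSpace X] [CompactSpace X] [T2Space X]
      [TotallyDisconnectedSpace X] (σ : G →* (X ≃ₜ X)), Function.Injective σ →
      IsWeaklyBranch ((clopenHom X).comp σ) → OccursOnSubalgebra ((clopenHom X).comp σ) ρC := by
    intro X _ _ _ _ σ hi hσ
    have hi' : Function.Injective ((clopenHom X).comp σ) := (clopenHom_injective X).comp hi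
    exact hσ.occursOnSubalgebra hG.1 hi' hCle hCc hCg fun a =>
      ⟨⟨_, hσ.isCentraliserClass_mk_rist hG.1 hi' a⟩, rfl⟩
  refine ⟨BC, BD, ρC, ρD, hCle, hCc, hCg, hDle, hDc, hDg, ?_, ?_, ?_, ?_, ?_⟩
  · intro hi
    refine ⟨StoneSpace.stoneHom_injective.comp hi, IsWeaklyBranch.stone ?_⟩
    refine hG.isWeaklyBranch_of_injective (fun α => ?_) hCle hCc hCg hi
    obtain ⟨β, hβ, h⟩ := α.2
    change α.1 ∈ _
    rw [h]
    exact hG.perp_mem_structureLattice hβ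
  · intro A _ ρ hi hρ
    exact ⟨hC A ρ hi hρ, (hC A ρ hi hρ).isQuotientOfStoneSpace⟩
  · intro X _ _ _ _ σ hi hσ
    exact ⟨hC' X σ hi hσ,
      IsQuotientOfStoneSpace.of_clopens (hC' X σ hi hσ).isQuotientOfStoneSpace⟩
  · intro A _ ρ hi hρ h
    have h' : HasLocallyOpenRistProducts ρ := h.elim (fun _ => hρ.hasLocallyOpenRistProducts hi) id
    exact hρ.1.occursOnSubalgebra hG.1 hi hDle hDc hDg fun a =>
      ⟨⟨_, hG.isDecompositionClass_mk_rist hρ.1.1 hi h' a⟩, rfl⟩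
  · intro X _ _ _ _ σ hi hρ h
    have hi' : Function.Injective ((clopenHom X).comp σ) := (clopenHom_injective X).comp hi
    have h' : HasLocallyOpenRistProducts ((clopenHom X).comp σ) :=
      h.elim (fun _ => hρ.hasLocallyOpenRistProducts hi') id
    exact hρ.1.occursOnSubalgebra hG.1 hi' hDle hDc hDg fun a =>
      ⟨⟨_, hG.isDecompositionClass_mk_rist hρ.1.1 hi' h' a⟩, rfl⟩
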